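/- **Model.** Let $X$ be a finite data domain. In the $(m,n)$-hybrid model a curator holds $m$ points of $X$, each of $n$ local agents holds one point of $X$, and a referee holds no input. All parties toss independent private coins; messages (elements of a countable set, e.g. finite bit strings) are exchanged only between the referee and the other parties, and each message depends on the sender's input, its coins and the messages it has received so far. At the end the referee writes an output. In one *exchange with the curator* the referee sends a message to the curator and receives an answer; in one *exchange with the agents* the referee simultaneously sends a message to each agent and receives an answer from each. For $n=0$ (only exchanges with the curator) this is the trusted curator model; for $m=0$ (only exchanges with the agents) it is the local model, and the number of rounds is the number of exchanges. The protocol is $\varepsilon$-differentially private if for the curator and for every agent $P$, every randomized adversary $A$ that replaces all other parties and may send arbitrary messages to $P$, all inputs $\mathbf x,\mathbf x'$ of $P$ differing in at most one entry, and every event $S$, $\Pr[A \text{ interacting with } P(\mathbf x)\text{ outputs an element of } S]\le e^{\varepsilon}\Pr[A \text{ interacting with } P(\mathbf x')\text{ outputs an element of } S]$. **Task.** Let $c,d,m$ be natural numbers. The 1-out-of-$2^d$-parity task with strings of length $c$ is given by strings $r_j\in\{0,1\}^c$ for $j\in\{0,1\}^d$ and by $s_1,\dots,s_{m+1}\in\{0,1\}^d$;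 put $s=s_1\oplus\cdots\oplus s_{m+1}$. Each input point is generated independently as follows: with probability $1/2$ it is $(x,(\langle x,r_j\rangle)_{j\in\{0,1\}^d})$ for a uniform $x\in\{0,1\}^c$ (inner products modulo 2), and with probability $1/2$ it is $(t,s_t)$ for a uniform $t\in\{1,\dots,m+1\}$. A protocol solves the task with error $\beta$ if for all $(r_j)_j$ and $s_1,\dots,s_{m+1}$ the referee outputs $r_s$ with probability at least $1-\beta$ over the input points and the coins of all parties. **Theorem.** Let $\varepsilon=\beta=1/4$. For every integer $c\ge1$ there are natural numbers $d=d(c)$, $m=m(c)$, $n=n(c)$, with $d=\Theta(\log c)$, $m=\Theta(c)$ and $n=\Theta(c^2\log c)$ (uniformly over $c\ge2$), such that: 1. There is an $\varepsilon$-differentially private protocol in the $(m,n)$-hybrid model that solves the 1-out-of-$2^d$-parity task with strings of length $c$ with error $\beta$, in which first each local agent sends one message to the referee (without receiving any information) and then the referee makes one exchange with the curator. 2. There is no $\varepsilon$-differentially private protocol in the $(m,n)$-hybrid model that solves this task with error $\beta$ in which the referee first makes any number of exchanges with the curator and then a single exchange with the agents. 3. In every $\varepsilon$-differentially private protocol in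 the local model with $n$ agents that solves this task with error $\beta$, the number of rounds is $2^{\Omega(c)}$ and $2^{\Omega(\sqrt{n/\log n})}$: there is a constant $\gamma>0$ such that for all sufficiently large $c$ the number of rounds is at least $2^{\gamma c}$ and at least $2^{\gamma\sqrt{n/\log n}}$. 4. No algorithm in the trusted curator model with $m$ input points, private or not, solves this task with error $\beta$. -/

import Mathlib

open MeasureTheory Filter Asymptotics
open scoped ENNReal

namespace HybridDP

/-- A party holding `ℓ` points of the data domain `X`, as an interactive randomized functionality.
It tosses its private coins once; whenever it receives a message it answers with a message that
is determined by its input, its coins, and the list of all messages received so far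
(the most recent one last). -/
structure Party (X : Type) (ℓ : ℕ) (Msg : Type) where
  Coins : Type
  [coinsMeasurableSpace : MeasurableSpace Coins]
  law : Measure Coins
  [isProbabilityMeasure : IsProbabilityMeasure law]
  reply : (Fin ℓ → X) → Coins → List Msg → Msg
  measurableSet_reply : ∀ x h v, MeasurableSet {ω | reply x ω h = v}

attribute [instance] Party.coinsMeasurableSpace Party.isProbabilityMeasure

/-- An adversary that controls everybody except one party: a randomized strategy which chooses the
next message from its coins and the answers received so far, and finally writes an output.
It need not follow any protocol. -/
structure Adversary (Msg : Type) where
  Coins : Type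
  [coinsMeasurableSpace : MeasurableSpace Coins]
  law : Measure Coins
  [isProbabilityMeasure : IsProbabilityMeasure law]
  Out : Type
  [outMeasurableSpace : MeasurableSpace Out]
  query : Coins → List Msg → Msg
  output : Coins → List Msg → Out
  measurableSet_query : ∀ h v, MeasurableSet {ω | query ω h = v}
  measurable_output : ∀ h, Measurable fun ω => output ω h

attribute [instance] Adversary.coinsMeasurableSpace Adversary.isProbabilityMeasure
  Adversary.outMeasurableSpace

/-- `k` exchanges between a party (input `x`, coins `ω`) and the deterministic strategy `A`:
the messages received by the party and the answers it gives, in chronological order. -/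
def Party.interact {X Msg : Type} {ℓ : ℕ} (P : Party X ℓ Msg) (x : Fin ℓ → X) (ω : P.Coins)
    (A : List Msg → Msg) : ℕ → List Msg × List Msg
  | 0 => ([], [])
  | k + 1 =>
    let h := P.interact x ω A k
    let received := h.1 ++ [A h.2]
    (received, h.2 ++ [P.reply x ω received])

/-- The probability that the adversary `A`, after `T` exchanges with the party `P` on input `x`,
has an output in `S`. -/
noncomputable def Adversary.outputProb {X Msg : Type} {ℓ : ℕ} (A : Adversary Msg)
    (P : Party X ℓ Msg) (T : ℕ) (x : Fin ℓ → X) (S : Set A.Out) : ℝ≥0∞ :=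
  (A.law.prod P.law) {ω | A.output ω.1 (P.interact x ω.2 (A.query ω.1) T).2 ∈ S}

/-- Two databases are neighboring if they differ in at most one entry. -/
def Neighboring {X : Type} {ℓ : ℕ} (x x' : Fin ℓ → X) : Prop :=
  x = x' ∨ ∃ i, ∀ j, j ≠ i → x j = x' j

/-- A party that takes part in `T` exchanges is `ε`-differentially private: whatever the other
parties do, their output distributions on neighboring inputs are `(ε, 0)`-close.
(Both directions are covered because `Neighboring` is symmetric.) -/
def Party.IsPrivate {X Msg : Type} {ℓ : ℕ} (P : Party X ℓ Msg) (T : ℕ) (ε : ℝ) : Prop :=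
  ∀ (A : Adversary Msg) (x x' : Fin ℓ → X), Neighboring x x' →
    ∀ S : Set A.Out, MeasurableSet S →
      A.outputProb P T x S ≤ ENNReal.ofReal (Real.exp ε) * A.outputProb P T x' S

/-- One exchange of messages: in a `curator` round the referee sends a message to the curator and
gets an answer; in an `agents` round it simultaneously sends a message to each local agent and gets
an answer from each of them. -/
inductive Round
  | curator
  | agents
deriving DecidableEq

/-- A protocol in the `(m, n)`-hybrid model over the data domain `X` whose exchanges follow the
schedule `σ`, and in which the referee writes an output in `Y`. Messages come from a countable set
(for example, finite bit strings); the coins come from arbitrary probability spaces. The referee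
sees the answers received so far: `Sum.inl` for the curator, `Sum.inr` for all agents. -/
structure Protocol (X Y : Type) (σ : List Round) (m n : ℕ) where
  Msg : Type
  [countable_msg : Countable Msg]
  curator : Party X m Msg
  agent : Fin n → Party X 1 Msg
  RefCoins : Type
  [refCoinsMeasurableSpace : MeasurableSpace RefCoins]
  refLaw : Measure RefCoins
  [isProbabilityMeasure : IsProbabilityMeasure refLaw]
  toCurator : RefCoins → List (Msg ⊕ (Fin n → Msg)) → Msg
  toAgent : RefCoins → List (Msg ⊕ (Fin n → Msg)) → Fin n → Msg
  output : RefCoins → List (Msg ⊕ (Fin n → Msg)) → Y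
  measurableSet_toCurator : ∀ h v, MeasurableSet {ω | toCurator ω h = v}
  measurableSet_toAgent : ∀ h i v, MeasurableSet {ω | toAgent ω h i = v}
  measurableSet_output : ∀ h v, MeasurableSet {ω | output ω h = v}

attribute [instance] Protocol.countable_msg Protocol.refCoinsMeasurableSpace
  Protocol.isProbabilityMeasure

namespace Protocol

variable {X Y : Type} {σ : List Round} {m n : ℕ}

/-- The coins of the referee, of the curator and of the agents. -/
abbrev Coins (P : Protocol X Y σ m n) : Type :=
  P.RefCoins × P.curator.Coins × (∀ i, (P.agent i).Coins)

/-- All parties toss their coins independently. -/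
noncomputable def coinLaw (P : Protocol X Y σ m n) : Measure P.Coins :=
  P.refLaw.prod (P.curator.law.prod (Measure.pi fun i => (P.agent i).law))

/-- Run the schedule `τ` on curator input `x`, agent inputs `y` and coins `ω`, starting from
the messages `hc` received so far by the curator, the messages `ha i` received so far by agent `i`,
and the answers `view` received so far by the referee; the value is the final view of
the referee. -/
def run (P : Protocol X Y σ m n) (x : Fin m → X) (y : Fin n → X) (ω : P.Coins) :
    List Round → List P.Msg → (Fin n → List P.Msg) → List (P.Msg ⊕ (Fin n → P.Msg)) →
      List (P.Msg ⊕ (Fin n → P.Msg))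
  | [], _, _, view => view
  | .curator :: τ, hc, ha, view =>
    let hc' := hc ++ [P.toCurator ω.1 view]
    P.run x y ω τ hc' ha (view ++ [Sum.inl (P.curator.reply x ω.2.1 hc')])
  | .agents :: τ, hc, ha, view =>
    let ha' := fun i => ha i ++ [P.toAgent ω.1 view i]
    P.run x y ω τ hc ha'
      (view ++ [Sum.inr fun i => (P.agent i).reply (fun _ => y i) (ω.2.2 i) (ha' i)])

/-- The output of the referee as a function of all inputs and coins. -/
def result (P : Protocol X Y σ m n) (x : Fin m → X) (y : Fin n → X) (ω : P.Coins) : Y :=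
  P.output ω.1 (P.run x y ω σ [] (fun _ => []) [])

/-- The probability, over the coins of all parties, that the referee outputs `v`. -/
noncomputable def outputProb (P : Protocol X Y σ m n) (x : Fin m → X) (y : Fin n → X) (v : Y) :
    ℝ≥0∞ :=
  P.coinLaw {ω | P.result x y ω = v}

/-- `ε`-differential privacy against a malicious coalition of all parties but one. Each party
takes part in as many exchanges as the schedule prescribes. The referee has no input. -/
def IsPrivate (P : Protocol X Y σ m n) (ε : ℝ) : Prop :=
  P.curator.IsPrivate (σ.count .curator) ε ∧ ∀ i, (P.agent i).IsPrivate (σ.count .agents) ε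

/-- The agents' messages do not depend on the contents of any message that they receive: for a
schedule with a single `agents` round, each agent just sends one message to the referee. -/
def AgentsIgnoreMessages (P : Protocol X Y σ m n) : Prop :=
  ∀ i y ω (h h' : List P.Msg), h.length = h'.length →
    (P.agent i).reply y ω h = (P.agent i).reply y ω h'

end Protocol

/-- Bit strings of length `k`; addition is bitwise exclusive or. -/
abbrev Bits (k : ℕ) : Type := Fin k → ZMod 2

/-- The data domain of the 1-out-of-`2^d`-parity task with strings of length `c` and `k` shares:
points `(x, (b_j)_j)` and points `(t, s_t)`. -/
abbrev Point (c d k : ℕ) : Type := (Bits c × (Bits d → ZMod 2)) ⊕ (Fin k × Bits d)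

/-- The distribution of one sample, for the strings `r` and the shares `s` (`k + 1` of them). -/
noncomputable def sampleLaw {c d k : ℕ} (r : Bits d → Bits c) (s : Fin (k + 1) → Bits d) :
    PMF (Point c d (k + 1)) :=
  (PMF.uniformOfFintype Bool).bind fun b =>
    if b then
      (PMF.uniformOfFintype (Bits c)).map fun x => Sum.inl (x, fun j => x ⬝ᵥ r j)
    else
      (PMF.uniformOfFintype (Fin (k + 1))).map fun t => Sum.inr (t, s t)

/-- The referee recovers `r_s`, where `s` is the exclusive or of the `k + 1` shares, with
probability at least `1 - β` over the `m + n` independent samples and the coins of the parties,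
for all strings `r` and all shares `s`. -/
def SolvesOneOutOfParity {c d k m n : ℕ} {σ : List Round}
    (P : Protocol (Point c d (k + 1)) (Bits c) σ m n) (β : ℝ) : Prop :=
  ∀ (r : Bits d → Bits c) (s : Fin (k + 1) → Bits d),
    ENNReal.ofReal (1 - β) ≤
      ∑ x : Fin m → Point c d (k + 1), ∑ y : Fin n → Point c d (k + 1),
        (∏ i, sampleLaw r s (x i)) * (∏ i, sampleLaw r s (y i)) *
          P.outputProb x y (r (∑ t, s t))

end HybridDP

/-!
*Hybrid protocol.* Each agent answers with a random sign table on the pairs `(t, v)`, slightly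
biased towards a plus sign at the pair it holds. For every `t` the true share `s t` is the `v` with
the most plus signs, so the referee learns `s`. It sends `s` to the curator, who runs the
exponential mechanism on the number of samples that contradict a candidate for `r_s`.

*Curator alone.* The `m` samples miss one of the `m + 1` shares, so they say nothing about `s`.

*Curator first.* Again the curator does not know `s`, and the queries to the agents do not depend
on it. By privacy the law of all answers changes by a factor of at most `e ^ (ε (m + n))` with the
strings, which is too little to learn more than a fixed fraction of the `2 ^ d` strings. The agents
who hold shares can be simulated by the referee for every possible value of `s`.

*Local model.* For random strings the labels `(⟨x, r_j⟩)_j` of distinct nonzero points `x` are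
independent. By orthogonality, in mean square over the strings, each agent's contribution to the
probability of a transcript therefore differs from its average by a factor that is only
`1 + O(2 ^ (-c / 2))`. So `n` agents reveal next to nothing about `r_s` unless `n ^ 2` is of order
`2 ^ c`, whatever the number of rounds.
-/

namespace HybridDP

section Interaction

variable {X Msg : Type} {ℓ : ℕ}

/-- The coins with which a party on input `x` produces a given log of pairs (message received,
answer given). Logs are listed with the most recent pair first, so that they grow by `::`. -/
def Party.consistentCoins (P : Party X ℓ Msg) (x : Fin ℓ → X) : List (Msg × Msg) → Set P.Coins
  | [] => Set.univ
  | p :: L => P.consistentCoins x L ∩ {ω | P.reply x ω ((p :: L).map Prod.fst).reverse = p.2}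

theorem Party.measurableSet_consistentCoins (P : Party X ℓ Msg) (x : Fin ℓ → X)
    (L : List (Msg × Msg)) : MeasurableSet (P.consistentCoins x L) := by
  induction L with
  | nil => exact MeasurableSet.univ
  | cons p L ih => exact ih.inter (P.measurableSet_reply _ _ _)

theorem Party.length_interact_snd (P : Party X ℓ Msg) (x : Fin ℓ → X) (ω : P.Coins)
    (A : List Msg → Msg) (k : ℕ) : (P.interact x ω A k).2.length = k := by
  induction k with
  | zero => rfl
  | succ k ih => simp [Party.interact, ih]

/-- The strategy `A` sends the messages of the log `L`, whatever the answers are. -/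
def AsksAlong (A : List Msg → Msg) (L : List (Msg × Msg)) : Prop :=
  ∀ p K, (p :: K) <:+ L → ∀ answers : List Msg, answers.length = K.length → A answers = p.1

theorem AsksAlong.of_cons {A : List Msg → Msg} {p : Msg × Msg} {L : List (Msg × Msg)}
    (hA : AsksAlong A (p :: L)) : AsksAlong A L :=
  fun q K hK => hA q K (hK.trans (List.suffix_cons p L))

theorem Party.interact_fst_of_asksAlong (P : Party X ℓ Msg) (x : Fin ℓ → X) (ω : P.Coins)
    {A : List Msg → Msg} {L : List (Msg × Msg)} (hA : AsksAlong A L) :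
    (P.interact x ω A L.length).1 = (L.map Prod.fst).reverse := by
  induction L with
  | nil => rfl
  | cons p L ih =>
    have query_eq : A (P.interact x ω A L.length).2 = p.1 :=
      hA p L (List.suffix_refl _) _ (P.length_interact_snd x ω A _)
    simp [Party.interact, ih hA.of_cons, query_eq]

theorem Party.interact_snd_eq_iff_of_asksAlong (P : Party X ℓ Msg) (x : Fin ℓ → X) (ω : P.Coins)
    {A : List Msg → Msg} {L : List (Msg × Msg)} (hA : AsksAlong A L) :
    (P.interact x ω A L.length).2 = (L.map Prod.snd).reverse ↔ ω ∈ P.consistentCoins x L := by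
  induction L with
  | nil => simp [Party.interact, Party.consistentCoins]
  | cons p L ih =>
    have snd_eq : (P.interact x ω A (p :: L).length).2 = (P.interact x ω A L.length).2 ++
        [P.reply x ω ((p :: L).map Prod.fst).reverse] := by
      rw [← P.interact_fst_of_asksAlong x ω hA]
      rfl
    rw [snd_eq, List.map_cons (f := Prod.snd), List.reverse_cons,
      List.append_singleton_inj, ih hA.of_cons]
    rfl

/-- The deterministic adversary that sends the messages of the log `L` and tests whether the
answers agree with it; `v` is what it sends once the log is exhausted. -/
noncomputable def Adversary.replay (L : List (Msg × Msg)) (v : Msg) : Adversary Msg where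
  Coins := Unit
  law := Measure.dirac ()
  Out := Prop
  query _ answers := ((L.map Prod.fst).reverse[answers.length]?).getD v
  output _ answers := answers = (L.map Prod.snd).reverse
  measurableSet_query _ _ := MeasurableSet.of_discrete
  measurable_output _ := measurable_const

theorem Adversary.asksAlong_replay (L : List (Msg × Msg)) (v : Msg)
    (u : (Adversary.replay L v).Coins) :
    AsksAlong ((Adversary.replay L v).query u) L := by
  rintro p K ⟨K', rfl⟩ answers h
  simp [Adversary.replay, h]

theorem Adversary.outputProb_replay (P : Party X ℓ Msg) (x : Fin ℓ → X) (L : List (Msg × Msg))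
    (v : Msg) :
    (Adversary.replay L v).outputProb P L.length x ({True} : Set Prop) =
      P.law (P.consistentCoins x L) := by
  have event_eq : {ω : (Adversary.replay L v).Coins × P.Coins | (Adversary.replay L v).output ω.1
      (P.interact x ω.2 ((Adversary.replay L v).query ω.1) L.length).2 ∈ ({True} : Set Prop)} =
      Set.univ ×ˢ P.consistentCoins x L := by
    ext ⟨u, ω⟩
    rw [Set.mem_prod, ← P.interact_snd_eq_iff_of_asksAlong x ω (asksAlong_replay L v u)]
    change ((_ : List Msg) = _) ∈ ({True} : Set Prop) ↔ _
    simp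
  refine (congrArg ((Adversary.replay L v).law.prod P.law) event_eq).trans ?_
  rw [Measure.prod_prod, measure_univ, one_mul]

theorem Party.IsPrivate.law_consistentCoins_le {P : Party X ℓ Msg} {T : ℕ} {ε : ℝ}
    (hP : P.IsPrivate T ε) {x x' : Fin ℓ → X} (hx : Neighboring x x') {L : List (Msg × Msg)}
    (hL : L.length = T) :
    P.law (P.consistentCoins x L) ≤
      ENNReal.ofReal (Real.exp ε) * P.law (P.consistentCoins x' L) := by
  obtain ⟨ω₀⟩ : Nonempty P.Coins := P.law.nonempty_of_neZero
  subst hL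
  rw [← Adversary.outputProb_replay P x L (P.reply x ω₀ []),
    ← Adversary.outputProb_replay P x' L (P.reply x ω₀ [])]
  exact hP (Adversary.replay L _) x x' hx ({True} : Set Prop) trivial

theorem le_pow_mul_of_forall_neighboring {f : (Fin ℓ → X) → ℝ≥0∞} {K : ℝ≥0∞}
    (hf : ∀ x x', Neighboring x x' → f x ≤ K * f x') (x x' : Fin ℓ → X) :
    f x ≤ K ^ ℓ * f x' := by
  have hybrid : ∀ k ≤ ℓ, f x ≤ K ^ k * f (fun i => if (i : ℕ) < k then x' i else x i) := by
    intro k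
    induction k with
    | zero => simp
    | succ k ih =>
      intro hk
      refine (ih (by omega)).trans ?_
      rw [pow_succ, mul_assoc]
      gcongr
      refine hf _ _ (Or.inr ⟨⟨k, hk⟩, fun j hj => ?_⟩)
      have : (j : ℕ) ≠ k := fun h => hj (Fin.ext h)
      simp only [show (j : ℕ) < k + 1 ↔ (j : ℕ) < k by omega]
  simpa using hybrid ℓ le_rfl

end Interaction

namespace Protocol

variable {X Y : Type} {σ : List Round} {m n : ℕ}

/-- What the referee has received, the most recent answer first: the reverse of the lists that
occur in `Protocol.run`, so that views grow by `::`. -/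
abbrev View (P : Protocol X Y σ m n) : Type := List (P.Msg ⊕ (Fin n → P.Msg))

/-- The log of the exchanges with the curator in a view, given the coins of the referee. -/
def curatorLog (P : Protocol X Y σ m n) (ρ : P.RefCoins) : P.View → List (P.Msg × P.Msg)
  | [] => []
  | .inl a :: B => (P.toCurator ρ B.reverse, a) :: P.curatorLog ρ B
  | .inr _ :: B => P.curatorLog ρ B

/-- The log of the exchanges with the `i`-th agent in a view, given the coins of the referee. -/
def agentLog (P : Protocol X Y σ m n) (ρ : P.RefCoins) (i : Fin n) :
    P.View → List (P.Msg × P.Msg)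
  | [] => []
  | .inl _ :: B => P.agentLog ρ i B
  | .inr b :: B => (P.toAgent ρ B.reverse i, b i) :: P.agentLog ρ i B

/-- The rounds in which the answers of a view were received, the most recent one first. -/
def shape (P : Protocol X Y σ m n) (B : P.View) : List Round :=
  B.map (Sum.elim (fun _ => .curator) fun _ => .agents)

theorem length_curatorLog (P : Protocol X Y σ m n) (ρ : P.RefCoins) (B : P.View) :
    (P.curatorLog ρ B).length = (P.shape B).count .curator := by
  induction B with
  | nil => rfl
  | cons b B ih => cases b <;> simpa [curatorLog, shape] using ih

theorem length_agentLog (P : Protocol X Y σ m n) (ρ : P.RefCoins) (i : Fin n) (B : P.View) :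
    (P.agentLog ρ i B).length = (P.shape B).count .agents := by
  induction B with
  | nil => rfl
  | cons b B ih => cases b <;> simpa [agentLog, shape] using ih

/-- The referee's view after the exchanges of a schedule. Unlike in `Protocol.run`, the schedule is
listed with the most recent round first, and the messages received by the other parties are
recovered from the view. -/
def revRun (P : Protocol X Y σ m n) (x : Fin m → X) (y : Fin n → X) (ω : P.Coins) :
    List Round → P.View
  | [] => []
  | .curator :: τ =>
    let B := P.revRun x y ω τ
    .inl (P.curator.reply x ω.2.1
      (P.toCurator ω.1 B.reverse :: (P.curatorLog ω.1 B).map Prod.fst).reverse) :: B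
  | .agents :: τ =>
    let B := P.revRun x y ω τ
    .inr (fun i => (P.agent i).reply (fun _ => y i) (ω.2.2 i)
      (P.toAgent ω.1 B.reverse i :: (P.agentLog ω.1 i B).map Prod.fst).reverse) :: B

theorem run_eq_reverse_revRun (P : Protocol X Y σ m n) (x : Fin m → X) (y : Fin n → X)
    (ω : P.Coins) (τ τ' : List Round) :
    P.run x y ω τ ((P.curatorLog ω.1 (P.revRun x y ω τ')).map Prod.fst).reverse
        (fun i => ((P.agentLog ω.1 i (P.revRun x y ω τ')).map Prod.fst).reverse)
        (P.revRun x y ω τ').reverse =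
      (P.revRun x y ω (τ.reverse ++ τ')).reverse := by
  induction τ generalizing τ' with
  | nil => rfl
  | cons a τ ih =>
    rw [List.reverse_cons, List.append_assoc, List.singleton_append, ← ih (a :: τ')]
    cases a <;> simp [run, revRun, curatorLog, agentLog]

theorem result_eq_output_revRun (P : Protocol X Y σ m n) (x : Fin m → X) (y : Fin n → X)
    (ω : P.Coins) : P.result x y ω = P.output ω.1 (P.revRun x y ω σ.reverse).reverse := by
  rw [result, ← List.append_nil σ.reverse, ← run_eq_reverse_revRun]
  rfl

theorem shape_revRun (P : Protocol X Y σ m n) (x : Fin m → X) (y : Fin n → X) (ω : P.Coins)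
    (τ : List Round) : P.shape (P.revRun x y ω τ) = τ := by
  induction τ with
  | nil => rfl
  | cons a τ ih => cases a <;> simpa [revRun, shape] using ih

theorem revRun_shape_eq_iff (P : Protocol X Y σ m n) (x : Fin m → X) (y : Fin n → X) (ω : P.Coins)
    (B : P.View) :
    P.revRun x y ω (P.shape B) = B ↔
      ω.2.1 ∈ P.curator.consistentCoins x (P.curatorLog ω.1 B) ∧
        ∀ i, ω.2.2 i ∈ (P.agent i).consistentCoins (fun _ => y i) (P.agentLog ω.1 i B) := by
  induction B with
  | nil => simp [revRun, shape, Party.consistentCoins, curatorLog, agentLog]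
  | cons b B ih =>
    cases b with
    | inl a =>
      rw [show P.shape (.inl a :: B) = .curator :: P.shape B from rfl]
      simp only [revRun, List.cons.injEq, curatorLog, agentLog, Party.consistentCoins,
        Set.mem_inter_iff, Set.mem_ofPred_eq, List.map_cons, Sum.inl.injEq]
      rw [and_right_comm, ← ih, and_comm]
      exact and_congr_right fun h => by rw [h]
    | inr b =>
      rw [show P.shape (.inr b :: B) = .agents :: P.shape B from rfl]
      simp only [revRun, List.cons.injEq, curatorLog, agentLog, Party.consistentCoins,
        Set.mem_inter_iff, Set.mem_ofPred_eq, List.map_cons, Sum.inr.injEq, funext_iff]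
      rw [forall_and, ← and_assoc, ← ih, and_comm]
      exact and_congr_right fun h => by rw [h]

theorem measurableSet_cons_eq {Ω α : Type*} [MeasurableSpace Ω] {f : Ω → α} {g : Ω → List α}
    (hf : ∀ a, MeasurableSet {ω | f ω = a}) (hg : ∀ l, MeasurableSet {ω | g ω = l}) (l : List α) :
    MeasurableSet {ω | f ω :: g ω = l} := by
  cases l with
  | nil => simp
  | cons a l => simpa only [List.cons.injEq, Set.ofPred_and] using (hf a).inter (hg l)

theorem measurableSet_prodMk_const_eq {Ω α β : Type*} [MeasurableSpace Ω] {f : Ω → α}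
    (hf : ∀ a, MeasurableSet {ω | f ω = a}) (b : β) (p : α × β) :
    MeasurableSet {ω | (f ω, b) = p} := by
  obtain ⟨a, b'⟩ := p
  simpa only [Prod.mk.injEq, Set.ofPred_and] using (hf a).inter (MeasurableSet.const (b = b'))

theorem measurableSet_curatorLog_eq (P : Protocol X Y σ m n) (B : P.View)
    (L : List (P.Msg × P.Msg)) : MeasurableSet {ρ | P.curatorLog ρ B = L} := by
  induction B generalizing L with
  | nil => exact MeasurableSet.const ([] = L)
  | cons b B ih =>
    cases b with
    | inl a =>
      exact measurableSet_cons_eq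
        (measurableSet_prodMk_const_eq (P.measurableSet_toCurator B.reverse) a) ih L
    | inr b => exact ih L

theorem measurableSet_agentLog_eq (P : Protocol X Y σ m n) (i : Fin n) (B : P.View)
    (L : List (P.Msg × P.Msg)) : MeasurableSet {ρ | P.agentLog ρ i B = L} := by
  induction B generalizing L with
  | nil => exact MeasurableSet.const ([] = L)
  | cons b B ih =>
    cases b with
    | inl a => exact ih L
    | inr b =>
      exact measurableSet_cons_eq
        (measurableSet_prodMk_const_eq (P.measurableSet_toAgent B.reverse i) (b i)) ih L

theorem measurableSet_revRun_shape_eq (P : Protocol X Y σ m n) (x : Fin m → X) (y : Fin n → X)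
    (B : P.View) : MeasurableSet {ω : P.Coins | P.revRun x y ω (P.shape B) = B} := by
  have event_eq : {ω : P.Coins | P.revRun x y ω (P.shape B) = B} =
      (⋃ L, {ω : P.Coins | P.curatorLog ω.1 B = L} ∩
        {ω | ω.2.1 ∈ P.curator.consistentCoins x L}) ∩
      ⋂ i, ⋃ L, {ω : P.Coins | P.agentLog ω.1 i B = L} ∩
        {ω | ω.2.2 i ∈ (P.agent i).consistentCoins (fun _ => y i) L} := by
    ext ω
    simp [revRun_shape_eq_iff]
  rw [event_eq]
  refine (MeasurableSet.iUnion fun L => ?_).inter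
    (MeasurableSet.iInter fun i => MeasurableSet.iUnion fun L => ?_)
  · exact (measurable_fst (P.measurableSet_curatorLog_eq B L)).inter
      ((measurable_fst.comp measurable_snd) (P.curator.measurableSet_consistentCoins x L))
  · exact (measurable_fst (P.measurableSet_agentLog_eq i B L)).inter
      (((measurable_pi_apply i).comp (measurable_snd.comp measurable_snd))
        ((P.agent i).measurableSet_consistentCoins _ L))

theorem measurableSet_revRun_eq (P : Protocol X Y σ m n) (x : Fin m → X) (y : Fin n → X)
    (τ : List Round) (B : P.View) : MeasurableSet {ω : P.Coins | P.revRun x y ω τ = B} := by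
  by_cases h : P.shape B = τ
  · exact h ▸ P.measurableSet_revRun_shape_eq x y B
  · have : ∀ ω, P.revRun x y ω τ ≠ B := fun ω hω => h (hω ▸ P.shape_revRun x y ω τ)
    simp [this]

theorem measurableSet_result_eq (P : Protocol X Y σ m n) (x : Fin m → X) (y : Fin n → X) (v : Y) :
    MeasurableSet {ω : P.Coins | P.result x y ω = v} := by
  have event_eq : {ω : P.Coins | P.result x y ω = v} = ⋃ B : P.View,
      {ω : P.Coins | P.revRun x y ω σ.reverse = B} ∩ {ω | P.output ω.1 B.reverse = v} := by
    ext ω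
    simp [result_eq_output_revRun]
  rw [event_eq]
  exact MeasurableSet.iUnion fun B => (P.measurableSet_revRun_eq x y _ B).inter
    (measurable_fst (P.measurableSet_output _ _))

/-- The joint law of the coins of the curator and of the agents. -/
noncomputable abbrev partyLaw (P : Protocol X Y σ m n) :
    Measure (P.curator.Coins × (∀ i, (P.agent i).Coins)) :=
  P.curator.law.prod (Measure.pi fun i => (P.agent i).law)

instance (P : Protocol X Y σ m n) : IsProbabilityMeasure P.coinLaw := by
  unfold coinLaw
  infer_instance

theorem outputProb_eq_lintegral (P : Protocol X Y σ m n) (x : Fin m → X) (y : Fin n → X) (v : Y) :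
    P.outputProb x y v = ∫⁻ ρ, P.partyLaw {ω | P.result x y (ρ, ω) = v} ∂P.refLaw := by
  rw [outputProb, coinLaw, Measure.prod_apply (P.measurableSet_result_eq x y v)]
  rfl

theorem outputProb_add_outputProb_le_one (P : Protocol X Y σ m n) (x : Fin m → X) (y : Fin n → X)
    {v w : Y} (h : v ≠ w) : P.outputProb x y v + P.outputProb x y w ≤ 1 := by
  rw [outputProb, outputProb, ← measure_union _ (P.measurableSet_result_eq x y w)]
  · exact prob_le_one
  · exact Set.disjoint_left.2 fun ω hv hw => h (hv.symm.trans hw)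

/-- The probability, over the coins of the curator and of the agents, that they answer as in the
view `B`. -/
noncomputable def viewProb (P : Protocol X Y σ m n) (ρ : P.RefCoins) (x : Fin m → X)
    (y : Fin n → X) (B : P.View) : ℝ≥0∞ :=
  P.curator.law (P.curator.consistentCoins x (P.curatorLog ρ B)) *
    ∏ i, (P.agent i).law ((P.agent i).consistentCoins (fun _ => y i) (P.agentLog ρ i B))

theorem partyLaw_revRun_shape_eq (P : Protocol X Y σ m n) (ρ : P.RefCoins) (x : Fin m → X)
    (y : Fin n → X) (B : P.View) :
    P.partyLaw {ω | P.revRun x y (ρ, ω) (P.shape B) = B} = P.viewProb ρ x y B := by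
  have event_eq : {ω | P.revRun x y (ρ, ω) (P.shape B) = B} =
      P.curator.consistentCoins x (P.curatorLog ρ B) ×ˢ
        Set.univ.pi fun i => (P.agent i).consistentCoins (fun _ => y i) (P.agentLog ρ i B) := by
    ext ω
    simp [revRun_shape_eq_iff]
  rw [event_eq, Measure.prod_prod, Measure.pi_pi, viewProb]

open Classical in
theorem partyLaw_revRun (P : Protocol X Y σ m n) (ρ : P.RefCoins) (x : Fin m → X)
    (y : Fin n → X) (τ : List Round) (p : P.View → Prop) :
    P.partyLaw {ω | p (P.revRun x y (ρ, ω) τ)} =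
      ∑' B : P.View, if P.shape B = τ ∧ p B then P.viewProb ρ x y B else 0 := by
  have event_eq : {ω | p (P.revRun x y (ρ, ω) τ)} = ⋃ B : P.View,
      {ω | P.revRun x y (ρ, ω) τ = B ∧ p B} := by
    ext ω
    simp
  rw [event_eq, measure_iUnion]
  · refine tsum_congr fun B => ?_
    split_ifs with h
    · obtain ⟨rfl, hp⟩ := h
      simpa only [hp, and_true] using P.partyLaw_revRun_shape_eq ρ x y B
    · have : ∀ ω, ¬ (P.revRun x y (ρ, ω) τ = B ∧ p B) := fun ω hω =>
        h ⟨hω.1 ▸ P.shape_revRun x y _ τ, hω.2⟩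
      simp [this]
  · exact fun B B' hB => Set.disjoint_left.2 fun ω h h' => hB (h.1.symm.trans h'.1)
  · intro B
    exact (measurable_prodMk_left (P.measurableSet_revRun_eq x y τ B)).inter (MeasurableSet.const _)

open Classical in
theorem tsum_viewProb (P : Protocol X Y σ m n) (ρ : P.RefCoins) (x : Fin m → X)
    (y : Fin n → X) (τ : List Round) :
    ∑' B : P.View, (if P.shape B = τ then P.viewProb ρ x y B else 0) = 1 := by
  simpa using (P.partyLaw_revRun ρ x y τ fun _ => True).symm

end Protocol

section FiniteAverages

variable {α β ι : Type*}

theorem sum_pmf_eq_one [Fintype α] (p : PMF α) : ∑ a, p a = 1 := by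
  rw [← tsum_fintype (L := .unconditional α), p.tsum_coe]

theorem sum_pmf_bind_mul [Fintype α] [Fintype β] (p : PMF α) (q : α → PMF β) (F : β → ℝ≥0∞) :
    ∑ b, p.bind q b * F b = ∑ a, p a * ∑ b, q a b * F b := by
  simp only [PMF.bind_apply, tsum_fintype, Finset.sum_mul, Finset.mul_sum, mul_assoc]
  exact Finset.sum_comm

theorem sum_pmf_map_mul [Fintype α] [Fintype β] (p : PMF α) (f : α → β) (F : β → ℝ≥0∞) :
    ∑ b, p.map f b * F b = ∑ a, p a * F (f a) := by
  classical
  rw [← PMF.bind_pure_comp, sum_pmf_bind_mul]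
  simp

theorem sum_uniformOfFintype_mul [Fintype α] [Nonempty α] (F : α → ℝ≥0∞) :
    ∑ a, PMF.uniformOfFintype α a * F a = (Fintype.card α : ℝ≥0∞)⁻¹ * ∑ a, F a := by
  simp only [PMF.uniformOfFintype_apply, Finset.mul_sum]

theorem sum_prod_mul_prod {R : Type*} [CommSemiring R] [Fintype ι] [DecidableEq ι] [Fintype α]
    (p : α → R) (G : ι → α → R) :
    ∑ y : ι → α, (∏ i, p (y i)) * ∏ i, G i (y i) = ∏ i, ∑ a, p a * G i a := by
  rw [Finset.prod_univ_sum, Fintype.piFinset_univ]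
  simp only [Finset.prod_mul_distrib]

theorem sum_prod_pmf_eq_one [Fintype ι] [DecidableEq ι] [Fintype α] (p : PMF α) :
    ∑ y : ι → α, ∏ i, p (y i) = 1 := by
  simpa [sum_pmf_eq_one] using sum_prod_mul_prod p fun (_ : ι) _ => 1

theorem sum_prod_pmf_mul_sum_prod [Fintype ι] [DecidableEq ι] [Fintype α] (p : PMF α)
    (q : α → PMF β) (S : Finset (ι → β)) :
    ∑ y : ι → α, (∏ i, p (y i)) * ∑ G ∈ S, ∏ i, q (y i) (G i) =
      ∑ G ∈ S, ∏ i, p.bind q (G i) := by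
  simp only [Finset.mul_sum, PMF.bind_apply, tsum_fintype]
  rw [Finset.sum_comm]
  exact Finset.sum_congr rfl fun G _ => sum_prod_mul_prod p fun i a => q a (G i)

theorem sum_prod_pmf_map_mul [Fintype ι] [DecidableEq ι] [Fintype α] [Fintype β] (p : PMF α)
    (f : α → β) (F : (ι → β) → ℝ≥0∞) :
    ∑ y : ι → β, (∏ i, p.map f (y i)) * F y =
      ∑ u : ι → α, (∏ i, p (u i)) * F fun i => f (u i) := by
  classical
  have prod_map_apply : ∀ y : ι → β, ∏ i, p.map f (y i) =
      ∑ u : ι → α, if (y = fun i => f (u i)) then ∏ i, p (u i) else 0 := by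
    intro y
    simp only [PMF.map_apply, tsum_fintype, Finset.prod_univ_sum, Fintype.piFinset_univ,
      Finset.prod_ite_zero, Finset.mem_univ, true_imp_iff, funext_iff]
  simp only [prod_map_apply, Finset.sum_mul, ite_mul, zero_mul]
  rw [Finset.sum_comm]
  simp only [Finset.sum_ite_eq', Finset.mem_univ, if_true]

theorem sum_le_card_mul_of_forall_sum_add_le [Fintype α] [AddGroup α] [Fintype β] [Nonempty β]
    (φ : β → α) {F : α → ℝ≥0∞} {b : ℝ≥0∞}
    (h : ∀ a, ∑ v, F (a + φ v) ≤ Fintype.card β * b) : ∑ a, F a ≤ Fintype.card α * b := by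
  have translate : ∀ v, ∑ a, F (a + φ v) = ∑ a, F a :=
    fun v => Fintype.sum_equiv (Equiv.addRight (φ v)) _ _ fun _ => rfl
  refine (ENNReal.mul_le_mul_iff_right (a := (Fintype.card β : ℝ≥0∞)) (by simp) (by simp)).1 ?_
  calc (Fintype.card β : ℝ≥0∞) * ∑ a, F a
      = ∑ v, ∑ a, F (a + φ v) := by simp [translate]
    _ = ∑ a, ∑ v, F (a + φ v) := Finset.sum_comm
    _ ≤ ∑ _a : α, Fintype.card β * b := Finset.sum_le_sum fun a _ => h a
    _ = Fintype.card β * (Fintype.card α * b) := by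
        rw [Finset.sum_const, Finset.card_univ, nsmul_eq_mul, mul_left_comm]

theorem sum_le_card_mul_inv_two [Fintype α] [AddGroup α] {F : α → ℝ≥0∞} (a : α)
    (h : ∀ j, F j + F (j + a) ≤ 1) : ∑ j, F j ≤ Fintype.card α * 2⁻¹ := by
  refine sum_le_card_mul_of_forall_sum_add_le (fun b : Bool => if b then a else 0) fun j => ?_
  rw [Fintype.sum_bool, Fintype.card_bool, Nat.cast_ofNat, ENNReal.mul_inv_cancel two_ne_zero
    ENNReal.ofNat_ne_top, add_comm]
  simpa using h j

end FiniteAverages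

section Sampling

variable {c d k : ℕ}

theorem sum_sampleLaw_mul (r : Bits d → Bits c) (s : Fin (k + 1) → Bits d)
    (F : Point c d (k + 1) → ℝ≥0∞) :
    ∑ z, sampleLaw r s z * F z =
      2⁻¹ * ((2 ^ c : ℝ≥0∞)⁻¹ * ∑ x, F (.inl (x, fun j => x ⬝ᵥ r j))) +
      2⁻¹ * ((k + 1 : ℝ≥0∞)⁻¹ * ∑ t, F (.inr (t, s t))) := by
  rw [sampleLaw, sum_pmf_bind_mul, Fintype.sum_bool]
  simp only [if_true, Bool.false_eq_true, if_false, sum_pmf_map_mul, sum_uniformOfFintype_mul]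
  simp

/-- The coins from which a sample is generated, independently of the strings and the shares: which
of the two kinds of points it is, and the point `x` and the index `t` for the two kinds. -/
abbrev Seed (c k : ℕ) : Type := Bool × Bits c × Fin (k + 1)

/-- The seeds are uniformly distributed. -/
noncomputable def seedLaw (c k : ℕ) : PMF (Seed c k) :=
  (PMF.uniformOfFintype Bool).bind fun b => (PMF.uniformOfFintype (Bits c)).bind fun x =>
    (PMF.uniformOfFintype (Fin (k + 1))).map fun t => (b, x, t)

/-- The sample generated from a seed. -/
def Seed.point (r : Bits d → Bits c) (s : Fin (k + 1) → Bits d) (u : Seed c k) :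
    Point c d (k + 1) :=
  if u.1 then .inl (u.2.1, fun j => u.2.1 ⬝ᵥ r j) else .inr (u.2.2, s u.2.2)

theorem sampleLaw_eq_map_seedLaw (r : Bits d → Bits c) (s : Fin (k + 1) → Bits d) :
    sampleLaw r s = (seedLaw c k).map (Seed.point r s) := by
  rw [sampleLaw, seedLaw, PMF.map_bind]
  congr 1
  funext b
  rw [PMF.map_bind]
  simp only [PMF.map_comp, Function.comp_def, Seed.point]
  cases b
  · simp only [Bool.false_eq_true, if_false, PMF.bind_const]
  · simp only [if_true, ← PMF.bind_pure_comp]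
    exact congrArg _ (funext fun x => (PMF.bind_const _ _).symm)

theorem SolvesOneOutOfParity.le_sum_seedLaw {m n : ℕ} {σ : List Round}
    {P : Protocol (Point c d (k + 1)) (Bits c) σ m n} {β : ℝ} (hP : SolvesOneOutOfParity P β)
    (r : Bits d → Bits c) (s : Fin (k + 1) → Bits d) :
    ENNReal.ofReal (1 - β) ≤ ∑ u : Fin m → Seed c k, (∏ i, seedLaw c k (u i)) *
      ∑ w : Fin n → Seed c k, (∏ i, seedLaw c k (w i)) *
        P.outputProb (fun i => (u i).point r s) (fun i => (w i).point r s) (r (∑ t, s t)) := by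
  refine (hP r s).trans_eq ?_
  simp only [mul_assoc, ← Finset.mul_sum, sampleLaw_eq_map_seedLaw, sum_prod_pmf_map_mul]

/-- Yao's principle: to bound the success probability of a protocol, fix the seeds of the samples
and average over a family of strings and shares. -/
theorem SolvesOneOutOfParity.le_of_forall_seeds {m n : ℕ} {σ : List Round}
    {P : Protocol (Point c d (k + 1)) (Bits c) σ m n} {β : ℝ} (hP : SolvesOneOutOfParity P β)
    {Θ : Type*} [Fintype Θ] [Nonempty Θ] (r : Θ → Bits d → Bits c)
    (s : Θ → Fin (k + 1) → Bits d) {b : ℝ≥0∞}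
    (h : ∀ (u : Fin m → Seed c k) (w : Fin n → Seed c k),
      ∑ θ, P.outputProb (fun i => (u i).point (r θ) (s θ)) (fun i => (w i).point (r θ) (s θ))
        (r θ (∑ t, s θ t)) ≤ Fintype.card Θ * b) :
    ENNReal.ofReal (1 - β) ≤ b := by
  refine (ENNReal.mul_le_mul_iff_right (a := (Fintype.card Θ : ℝ≥0∞)) (by simp) (by simp)).1 ?_
  calc (Fintype.card Θ : ℝ≥0∞) * ENNReal.ofReal (1 - β)
      = ∑ _θ : Θ, ENNReal.ofReal (1 - β) := by simp
    _ ≤ _ := Finset.sum_le_sum fun θ _ => hP.le_sum_seedLaw (r θ) (s θ)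
    _ = ∑ u : Fin m → Seed c k, (∏ i, seedLaw c k (u i)) *
          ∑ w : Fin n → Seed c k, (∏ i, seedLaw c k (w i)) *
            ∑ θ, P.outputProb (fun i => (u i).point (r θ) (s θ))
              (fun i => (w i).point (r θ) (s θ)) (r θ (∑ t, s θ t)) := by
      rw [Finset.sum_comm]
      refine Finset.sum_congr rfl fun u _ => ?_
      rw [← Finset.mul_sum, Finset.sum_comm]
      simp only [Finset.mul_sum]
    _ ≤ ∑ u : Fin m → Seed c k, (∏ i, seedLaw c k (u i)) *
          ∑ w : Fin n → Seed c k, (∏ i, seedLaw c k (w i)) * (Fintype.card Θ * b) := by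
      gcongr with u _ w _
      exact h u w
    _ = Fintype.card Θ * b := by
      simp only [← Finset.sum_mul, sum_prod_pmf_eq_one, one_mul]

theorem exists_forall_seed_index_ne {ℓ : ℕ} (hℓ : ℓ ≤ k) (u : Fin ℓ → Seed c k) :
    ∃ t, ∀ i, (u i).2.2 ≠ t := by
  by_contra! h
  have := Fintype.card_le_of_surjective (fun i => (u i).2.2) h
  simp only [Fintype.card_fin] at this
  omega

theorem Seed.point_add_single {u : Seed c k} {t : Fin (k + 1)} (h : u.2.2 ≠ t)
    (r : Bits d → Bits c) (s : Fin (k + 1) → Bits d) (v : Bits d) :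
    u.point r (s + (Pi.single t v : Fin (k + 1) → Bits d)) = u.point r s := by
  simp [Seed.point, h]

theorem sum_add_single {ι A : Type*} [Fintype ι] [DecidableEq ι] [AddCommMonoid A] (s : ι → A)
    (t : ι) (v : A) : ∑ i, (s + (Pi.single t v : ι → A)) i = ∑ i, s i + v := by
  simp [Finset.sum_add_distrib]

end Sampling

/-- Some share `s t` does not occur among the samples, so that `∑ t, s t` is uniform given the
samples, and for some strings the output is right for at most one of `j` and `j + e`. -/
theorem not_solvesOneOutOfParity_of_no_agents {c d k m : ℕ} {σ : List Round} (hc : 1 ≤ c)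
    (hd : 1 ≤ d) (hm : m ≤ k) {β : ℝ} (hβ : β < 1 / 2)
    (P : Protocol (Point c d (k + 1)) (Bits c) σ m 0) : ¬ SolvesOneOutOfParity P β := by
  intro hP
  let e : Bits d := Pi.single ⟨0, hd⟩ 1
  let r : Bits d → Bits c := fun j _ => j ⟨0, hd⟩
  have r_add_ne (j : Bits d) : r j ≠ r (j + e) := fun h => by
    simpa [r, e] using congrFun h ⟨0, hc⟩
  have success_le : ENNReal.ofReal (1 - β) ≤ 2⁻¹ := by
    refine hP.le_of_forall_seeds (Θ := Fin (k + 1) → Bits d) (fun _ => r) (fun s => s)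
      fun u w => ?_
    obtain ⟨t, ht⟩ := exists_forall_seed_index_ne hm u
    refine sum_le_card_mul_of_forall_sum_add_le (Pi.single t) fun s => ?_
    refine sum_le_card_mul_inv_two e fun v => ?_
    simp only [sum_add_single, Seed.point_add_single (ht _),
      Subsingleton.elim (fun i => (w i).point r _) Fin.elim0]
    rw [← add_assoc]
    exact P.outputProb_add_outputProb_le_one _ _ (r_add_ne _)
  have inv_two_lt : (2⁻¹ : ℝ≥0∞) < ENNReal.ofReal (1 - β) := by
    rw [← ENNReal.ofReal_ofNat, ← ENNReal.ofReal_inv_of_pos two_pos]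
    exact (ENNReal.ofReal_lt_ofReal_iff (by linarith)).2 (by linarith)
  exact success_le.not_gt inv_two_lt

section Guessing

variable {J V : Type*} [Fintype J] [Fintype V] [DecidableEq J] [DecidableEq V]

theorem sum_one_add_pow_card_agree {R : Type*} [CommSemiring R] (o : J → V) (a : R) :
    ∑ r : J → V, (1 + a) ^ Finset.card {j | o j = r j} =
      (Fintype.card V + a) ^ Fintype.card J := by
  have pow_eq_prod (r : J → V) : (1 + a) ^ Finset.card {j | o j = r j} =
      ∏ j, (1 + if o j = r j then a else 0) := by
    simp only [add_ite, add_zero, Finset.prod_ite, Finset.prod_const, one_pow, mul_one]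
  simp only [pow_eq_prod]
  rw [← Fintype.piFinset_univ, ← Finset.prod_univ_sum (fun _ => Finset.univ)
    fun j v => 1 + if o j = v then a else 0]
  simp [Finset.sum_add_distrib]

/-- Markov's inequality for `(3 / 2) ^ N`, where `N` is the number of agreements: its average is at
most `(5 / 4) ^ (8 * Q)`, and `(5 / 4) ^ 8 ≤ (3 / 2) ^ 5 * (4 / 5)`. -/
theorem card_five_mul_lt_card_agree_le (hV : 2 ≤ Fintype.card V) {Q : ℕ}
    (hJ : Fintype.card J = 8 * Q) (o : J → V) :
    (Finset.card {r : J → V | 5 * Q < Finset.card {j | o j = r j}} : ℝ) ≤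
      (4 / 5) ^ Q * Fintype.card (J → V) := by
  have hV' : (2 : ℝ) ≤ Fintype.card V := by exact_mod_cast hV
  have markov : (Finset.card {r : J → V | 5 * Q < Finset.card {j | o j = r j}} : ℝ) *
      (1 + 1 / 2) ^ (5 * Q) ≤ (Fintype.card V + 1 / 2) ^ (8 * Q) := by
    rw [← hJ, ← sum_one_add_pow_card_agree o, ← nsmul_eq_mul, ← Finset.sum_const]
    refine (Finset.sum_le_sum fun r hr => ?_).trans
      (Finset.sum_le_sum_of_subset_of_nonneg (Finset.subset_univ _) fun r _ _ => by positivity)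
    exact pow_le_pow_right₀ (by norm_num) (Finset.mem_filter.1 hr).2.le
  refine le_of_mul_le_mul_right (markov.trans ?_) (by positivity)
  calc ((Fintype.card V : ℝ) + 1 / 2) ^ (8 * Q) ≤ (5 / 4 * Fintype.card V) ^ (8 * Q) := by
        gcongr
        linarith
    _ = ((5 / 4) ^ 8) ^ Q * Fintype.card (J → V) := by
        rw [mul_pow, Fintype.card_fun, hJ, ← pow_mul]
        push_cast
        ring
    _ ≤ ((1 + 1 / 2) ^ 5 * (4 / 5)) ^ Q * Fintype.card (J → V) := by
        gcongr
        norm_num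
    _ = _ := by rw [mul_pow, ← pow_mul]; ring

theorem sum_sum_ite_agree_le (hV : 2 ≤ Fintype.card V) {Q : ℕ} (hJ : Fintype.card J = 8 * Q)
    (o : J → V) {w : (J → V) → ℝ≥0∞} {M : ℝ≥0∞} (hw : ∀ r, w r ≤ M) :
    ∑ r, ∑ j, (if o j = r j then w r else 0) ≤ Fintype.card J *
      (ENNReal.ofReal (5 / 8) * ∑ r, w r +
        M * (ENNReal.ofReal ((4 / 5) ^ Q) * Fintype.card (J → V))) := by
  let N (r : J → V) : ℕ := Finset.card {j | o j = r j}
  have few_large : (Finset.card {r : J → V | 5 * Q < N r} : ℝ≥0∞) ≤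
      ENNReal.ofReal ((4 / 5) ^ Q) * Fintype.card (J → V) := by
    have := ENNReal.ofReal_le_ofReal (card_five_mul_lt_card_agree_le hV hJ o)
    rwa [ENNReal.ofReal_natCast, ENNReal.ofReal_mul (by positivity), ENNReal.ofReal_natCast] at this
  have five_mul : ((5 * Q : ℕ) : ℝ≥0∞) = Fintype.card J * ENNReal.ofReal (5 / 8) := by
    rw [hJ, ← ENNReal.ofReal_natCast, ← ENNReal.ofReal_natCast (8 * Q),
      ← ENNReal.ofReal_mul (by positivity)]
    congr 1
    push_cast
    ring
  calc ∑ r, ∑ j, (if o j = r j then w r else 0) = ∑ r, (N r : ℝ≥0∞) * w r := by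
        simp only [Finset.sum_ite, Finset.sum_const, nsmul_eq_mul, mul_zero, add_zero, N]
    _ ≤ ∑ r, ((5 * Q : ℕ) * w r + if 5 * Q < N r then Fintype.card J * M else 0) := by
        refine Finset.sum_le_sum fun r _ => ?_
        split_ifs with h
        · have : N r ≤ Fintype.card J := Finset.card_le_univ _
          refine le_add_left ?_
          gcongr
          exact hw r
        · have := not_lt.1 h
          rw [add_zero]
          gcongr
    _ = Fintype.card J * (ENNReal.ofReal (5 / 8) * ∑ r, w r +
          M * Finset.card {r : J → V | 5 * Q < N r}) := by
        rw [Finset.sum_add_distrib, ← Finset.mul_sum, ← Finset.sum_filter, Finset.sum_const,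
          nsmul_eq_mul, five_mul]
        ring
    _ ≤ _ := by gcongr

/-- If the laws `w r` of an observation are all dominated by `K` times one of them, then nobody
who sees the observation can guess `r j` for an average `j`, unless `K` is huge. -/
theorem sum_sum_tsum_ite_agree_le {β : Type*} (hV : 2 ≤ Fintype.card V) {Q : ℕ}
    (hJ : Fintype.card J = 8 * Q) (o : β → J → V) (w : (J → V) → β → ℝ≥0∞) (r₀ : J → V)
    {K : ℝ≥0∞} (hw : ∀ r B, w r B ≤ K * w r₀ B) (hw_one : ∀ r, ∑' B, w r B ≤ 1) :
    ∑ r, ∑ j, ∑' B, (if o B j = r j then w r B else 0) ≤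
      Fintype.card (J → V) *
        (Fintype.card J * (ENNReal.ofReal (5 / 8) + K * ENNReal.ofReal ((4 / 5) ^ Q))) := by
  calc ∑ r, ∑ j, ∑' B, (if o B j = r j then w r B else 0)
      = ∑' B, ∑ r, ∑ j, (if o B j = r j then w r B else 0) := by
        simp only [Summable.tsum_finsetSum fun _ _ => ENNReal.summable]
    _ ≤ ∑' B, Fintype.card J * (ENNReal.ofReal (5 / 8) * ∑ r, w r B +
          K * w r₀ B * (ENNReal.ofReal ((4 / 5) ^ Q) * Fintype.card (J → V))) :=
        ENNReal.tsum_le_tsum fun B => sum_sum_ite_agree_le hV hJ (o B) fun r => hw r B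
    _ = Fintype.card J * (ENNReal.ofReal (5 / 8) * ∑ r, ∑' B, w r B +
          K * (∑' B, w r₀ B) * (ENNReal.ofReal ((4 / 5) ^ Q) * Fintype.card (J → V))) := by
        simp only [ENNReal.tsum_add, ENNReal.tsum_mul_left, ENNReal.tsum_mul_right,
          Summable.tsum_finsetSum fun _ _ => ENNReal.summable]
    _ ≤ Fintype.card J * (ENNReal.ofReal (5 / 8) * ∑ _r : J → V, 1 +
          K * 1 * (ENNReal.ofReal ((4 / 5) ^ Q) * Fintype.card (J → V))) := by
        gcongr with r _
        · exact hw_one r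
        · exact hw_one r₀
    _ = _ := by
        rw [Finset.sum_const, Finset.card_univ, nsmul_eq_mul]
        ring

end Guessing

section IndependentCoins

theorem sum_lintegral_le_lintegral_sum {α ι : Type*} [MeasurableSpace α] (μ : Measure α)
    (s : Finset ι) (f : ι → α → ℝ≥0∞) :
    ∑ i ∈ s, ∫⁻ a, f i a ∂μ ≤ ∫⁻ a, ∑ i ∈ s, f i a ∂μ := by
  induction s using Finset.cons_induction_on with
  | empty => simp
  | cons i s hi ih =>
    simp only [Finset.sum_cons]
    grw [ih]
    exact le_lintegral_add _ _

theorem measurePreserving_pi_ite {ι : Type*} [Fintype ι] {α : ι → Type*}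
    [∀ i, MeasurableSpace (α i)] (μ : ∀ i, Measure (α i)) [∀ i, IsProbabilityMeasure (μ i)]
    (S : ι → Prop) [DecidablePred S] :
    MeasurePreserving (fun (p : (∀ i, α i) × ∀ i, α i) i => if S i then p.1 i else p.2 i)
      ((Measure.pi μ).prod (Measure.pi μ)) (Measure.pi μ) := by
  have measurable_ite : Measurable
      (fun (p : (∀ i, α i) × ∀ i, α i) i => if S i then p.1 i else p.2 i) := by
    refine measurable_pi_lambda _ fun i => ?_
    split_ifs <;> fun_prop
  refine ⟨measurable_ite, (Measure.pi_eq fun s hs => ?_).symm⟩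
  have preimage_box : (fun (p : (∀ i, α i) × ∀ i, α i) i => if S i then p.1 i else p.2 i) ⁻¹'
      Set.univ.pi s = (Set.univ.pi fun i => if S i then s i else Set.univ) ×ˢ
        (Set.univ.pi fun i => if S i then Set.univ else s i) := by
    ext p
    simp only [Set.mem_preimage, Set.mem_pi, Set.mem_univ, true_imp_iff, Set.mem_prod,
      ← forall_and]
    refine forall_congr' fun i => ?_
    split_ifs <;> simp
  rw [Measure.map_apply measurable_ite (MeasurableSet.univ_pi hs), preimage_box, Measure.prod_prod,
    Measure.pi_pi, Measure.pi_pi, ← Finset.prod_mul_distrib]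
  refine Finset.prod_congr rfl fun i _ => ?_
  split_ifs <;> simp

end IndependentCoins

namespace Protocol

variable {X Y : Type} {σ : List Round} {m n : ℕ}

theorem revRun_replicate_curator (P : Protocol X Y σ m n) (x : Fin m → X) (y y' : Fin n → X)
    (ρ : P.RefCoins) (ω : P.curator.Coins) (η η' : ∀ i, (P.agent i).Coins) (k : ℕ) :
    P.revRun x y (ρ, ω, η) (List.replicate k .curator) =
      P.revRun x y' (ρ, ω, η') (List.replicate k .curator) := by
  induction k with
  | zero => rfl
  | succ k ih => simp only [List.replicate_succ, revRun, ih]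

/-- Replace the last answers of the agents outside `S` by those for the inputs `y` and
the coins `η`. -/
def overrideLast (P : Protocol X Y σ m n) (ρ : P.RefCoins) (S : Fin n → Prop) [DecidablePred S]
    (y : Fin n → X) (η : ∀ i, (P.agent i).Coins) : P.View → P.View
  | .inr b :: B => .inr (fun i => if S i then b i else (P.agent i).reply (fun _ => y i) (η i)
      (P.toAgent ρ B.reverse i :: (P.agentLog ρ i B).map Prod.fst).reverse) :: B
  | B => B

theorem revRun_agents_cons_replicate_ite (P : Protocol X Y σ m n) (x : Fin m → X)
    (y z : Fin n → X) (ρ : P.RefCoins) (ω : P.curator.Coins) (ξ η : ∀ i, (P.agent i).Coins)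
    (S : Fin n → Prop) [DecidablePred S] (k : ℕ) :
    P.revRun x (fun i => if S i then z i else y i) (ρ, ω, fun i => if S i then ξ i else η i)
        (.agents :: List.replicate k .curator) =
      P.overrideLast ρ S y η
        (P.revRun x z (ρ, ω, ξ) (.agents :: List.replicate k .curator)) := by
  simp only [revRun, overrideLast]
  rw [P.revRun_replicate_curator x (fun i => if S i then z i else y i) z ρ ω
    (fun i => if S i then ξ i else η i) ξ k]
  congr 2
  funext i
  split_ifs <;> rfl

open Classical in
/-- The referee can simulate the agents outside `S` after having seen the view `B`, because they
answer only once, at the very end. -/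
theorem partyLaw_result_ite {k : ℕ}
    (P : Protocol X Y (List.replicate k .curator ++ [.agents]) m n) (x : Fin m → X)
    (y z : Fin n → X) (ρ : P.RefCoins) (S : Fin n → Prop) [DecidablePred S] (v : Y) :
    P.partyLaw {ω | P.result x (fun i => if S i then z i else y i) (ρ, ω) = v} =
      ∫⁻ η, ∑' B : P.View, (if P.shape B = .agents :: List.replicate k .curator ∧
        P.output ρ (P.overrideLast ρ S y η B).reverse = v then P.viewProb ρ x z B else 0)
        ∂Measure.pi fun i => (P.agent i).law := by
  have reverse_schedule : (List.replicate k Round.curator ++ [Round.agents]).reverse =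
      .agents :: List.replicate k .curator := by simp
  have measurableSet_result :
      MeasurableSet {ω | P.result x (fun i => if S i then z i else y i) (ρ, ω) = v} :=
    measurable_prodMk_left (P.measurableSet_result_eq x _ v)
  have resample := ((MeasurePreserving.id P.curator.law).prod
    (measurePreserving_pi_ite (fun i => (P.agent i).law) S)).comp
    (measurePreserving_prodAssoc P.curator.law (Measure.pi fun i => (P.agent i).law)
      (Measure.pi fun i => (P.agent i).law))
  rw [← resample.measure_preimage measurableSet_result.nullMeasurableSet,
    Measure.prod_apply_symm (resample.measurable measurableSet_result)]
  refine lintegral_congr fun η => ?_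
  rw [← P.partyLaw_revRun ρ x z _ fun B => P.output ρ (P.overrideLast ρ S y η B).reverse = v]
  congr 1
  ext ω
  change P.result x _ (ρ, ω.1, fun i => if S i then ω.2 i else η i) = v ↔ _
  rw [result_eq_output_revRun, reverse_schedule,
    P.revRun_agents_cons_replicate_ite x y z ρ ω.1 ω.2 η S k]
  rfl

theorem IsPrivate.viewProb_le {P : Protocol X Y σ m n} {ε : ℝ} (hP : P.IsPrivate ε)
    (ρ : P.RefCoins) (x x' : Fin m → X) (y y' : Fin n → X) {B : P.View}
    (hB : P.shape B = σ.reverse) :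
    P.viewProb ρ x y B ≤ ENNReal.ofReal (Real.exp ε) ^ (m + n) * P.viewProb ρ x' y' B := by
  have curator_le := le_pow_mul_of_forall_neighboring
    (f := fun x => P.curator.law (P.curator.consistentCoins x (P.curatorLog ρ B)))
    (fun x x' hx => hP.1.law_consistentCoins_le hx
      (by rw [length_curatorLog, hB, List.count_reverse])) x x'
  have agent_le (i : Fin n) :
      (P.agent i).law ((P.agent i).consistentCoins (fun _ => y i) (P.agentLog ρ i B)) ≤
      ENNReal.ofReal (Real.exp ε) *
        (P.agent i).law ((P.agent i).consistentCoins (fun _ => y' i) (P.agentLog ρ i B)) :=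
    (hP.2 i).law_consistentCoins_le (Or.inr ⟨0, fun j hj => (hj (Subsingleton.elim _ _)).elim⟩)
      (by rw [length_agentLog, hB, List.count_reverse])
  calc P.viewProb ρ x y B ≤ _ :=
        mul_le_mul' curator_le (Finset.prod_le_prod' fun i _ => agent_le i)
    _ = _ := by
      rw [Finset.prod_mul_distrib, Finset.prod_const, Finset.card_univ, Fintype.card_fin, viewProb,
        pow_add]
      ring

/-- The inputs of the agents outside `S` may depend on `j` because the queries do not: everything
else that the referee sees is the same for all `j`. -/
theorem IsPrivate.sum_outputProb_ite_le {J V : Type} [Fintype J] [Fintype V] [DecidableEq J]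
    {k Q : ℕ} {ε : ℝ}
    {P : Protocol X V (List.replicate k .curator ++ [.agents]) m n} (hP : P.IsPrivate ε)
    (hV : 2 ≤ Fintype.card V) (hJ : Fintype.card J = 8 * Q) (S : Fin n → Prop) [DecidablePred S]
    (x : (J → V) → Fin m → X) (y : J → Fin n → X) (z : (J → V) → Fin n → X) :
    ∑ r : J → V, ∑ j, P.outputProb (x r) (fun i => if S i then z r i else y j i) (r j) ≤
      Fintype.card (J → V) * (Fintype.card J * (ENNReal.ofReal (5 / 8) +
        ENNReal.ofReal (Real.exp ε) ^ (m + n) * ENNReal.ofReal ((4 / 5) ^ Q))) := by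
  classical
  let w (ρ : P.RefCoins) (r : J → V) (B : P.View) : ℝ≥0∞ :=
    if P.shape B = .agents :: List.replicate k .curator then P.viewProb ρ (x r) (z r) B else 0
  let guess (ρ : P.RefCoins) (η : ∀ i, (P.agent i).Coins) (B : P.View) (j : J) : V :=
    P.output ρ (P.overrideLast ρ S (y j) η B).reverse
  have : Nonempty V := Fintype.card_pos_iff.1 (by omega)
  obtain ⟨r₀⟩ : Nonempty (J → V) := inferInstance
  have guess_le ρ η : ∑ r, ∑ j, ∑' B, (if guess ρ η B j = r j then w ρ r B else 0) ≤
      Fintype.card (J → V) * (Fintype.card J * (ENNReal.ofReal (5 / 8) +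
        ENNReal.ofReal (Real.exp ε) ^ (m + n) * ENNReal.ofReal ((4 / 5) ^ Q))) := by
    refine sum_sum_tsum_ite_agree_le hV hJ (guess ρ η) (w ρ) r₀ (fun r B => ?_)
      fun r => (P.tsum_viewProb ρ (x r) (z r) _).le
    simp only [w]
    split_ifs with h
    · exact hP.viewProb_le ρ _ _ _ _ (by simp [h])
    · simp
  calc ∑ r : J → V, ∑ j, P.outputProb (x r) (fun i => if S i then z r i else y j i) (r j)
      = ∑ r, ∑ j, ∫⁻ ρ, ∫⁻ η, ∑' B, (if guess ρ η B j = r j then w ρ r B else 0)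
          ∂(Measure.pi fun i => (P.agent i).law) ∂P.refLaw := by
        simp only [outputProb_eq_lintegral, partyLaw_result_ite, guess, w, ← ite_and, and_comm]
    _ ≤ ∫⁻ ρ, ∫⁻ η, ∑ r, ∑ j, ∑' B, (if guess ρ η B j = r j then w ρ r B else 0)
          ∂(Measure.pi fun i => (P.agent i).law) ∂P.refLaw := by
        grw [Finset.sum_le_sum fun r _ => sum_lintegral_le_lintegral_sum _ _ _,
          sum_lintegral_le_lintegral_sum]
        refine lintegral_mono fun ρ => ?_
        grw [Finset.sum_le_sum fun r _ => sum_lintegral_le_lintegral_sum _ _ _,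
          sum_lintegral_le_lintegral_sum]
    _ ≤ _ := by
        grw [lintegral_mono fun ρ => lintegral_mono fun η => guess_le ρ η]
        simp only [lintegral_const, measure_univ, mul_one, le_refl]

end Protocol

theorem exp_quarter_le : Real.exp (1 / 4) ≤ 4 / 3 := by
  have := Real.exp_bound_div_one_sub_of_interval (x := 1 / 4) (by norm_num) (by norm_num)
  norm_num at this ⊢
  linarith

theorem exp_quarter_pow_mul_le {N Q : ℕ} (hQ : 2 * N + 16 ≤ Q) :
    Real.exp (1 / 4) ^ N * (4 / 5) ^ Q ≤ 1 / 16 := by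
  have exp_le : Real.exp (1 / 4) ≤ (5 / 4) ^ 2 := exp_quarter_le.trans (by norm_num)
  calc Real.exp (1 / 4) ^ N * (4 / 5) ^ Q
      ≤ ((5 / 4) ^ 2) ^ N * (4 / 5) ^ (2 * N + 16) := by
        gcongr ?_ ^ N * ?_
        exact pow_le_pow_of_le_one (by norm_num) (by norm_num) hQ
    _ = ((5 / 4) * (4 / 5)) ^ (2 * N) * (4 / 5) ^ 16 := by
        rw [← pow_mul, mul_pow, pow_add, mul_assoc]
    _ ≤ 1 / 16 := by norm_num

/-- If the curator is asked first and the agents only once afterwards, then the queries to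
the agents cannot depend on the hidden string index, and privacy bounds what all answers together
reveal about the `2 ^ d` strings. -/
theorem not_solvesOneOutOfParity_of_curator_first {c d m n k : ℕ} (hc : 1 ≤ c) (hd : 3 ≤ d)
    (hdmn : 16 * (m + n) + 128 ≤ 2 ^ d)
    {P : Protocol (Point c d (m + 1)) (Bits c) (List.replicate k .curator ++ [.agents]) m n}
    (hP : P.IsPrivate (1 / 4)) : ¬ SolvesOneOutOfParity P (1 / 4) := by
  intro hsol
  obtain ⟨e, rfl⟩ := Nat.exists_eq_add_of_le hd
  have card_index : Fintype.card (Bits (3 + e)) = 8 * 2 ^ e := by simp [pow_add]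
  have two_le_card : 2 ≤ Fintype.card (Bits c) := by
    simpa using Nat.pow_le_pow_right (n := 2) (by norm_num) hc
  have success_le : ENNReal.ofReal (1 - 1 / 4) ≤ ENNReal.ofReal (5 / 8) +
      ENNReal.ofReal (Real.exp (1 / 4)) ^ (m + n) * ENNReal.ofReal ((4 / 5) ^ 2 ^ e) := by
    refine hsol.le_of_forall_seeds
      (Θ := (Bits (3 + e) → Bits c) × (Fin (m + 1) → Bits (3 + e))) Prod.fst Prod.snd fun u w => ?_
    obtain ⟨t, ht⟩ := exists_forall_seed_index_ne le_rfl u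
    rw [Fintype.sum_prod_type_right, Fintype.card_prod, Nat.cast_mul, mul_comm (Nat.cast _),
      mul_assoc]
    refine sum_le_card_mul_of_forall_sum_add_le (Pi.single t) fun s => ?_
    simp only [sum_add_single, Seed.point_add_single (ht _)]
    have guess_le := hP.sum_outputProb_ite_le two_le_card card_index (fun i => (w i).1 = true)
      (fun r i => (u i).point r s)
      (fun j i => .inr ((w i).2.2, s (w i).2.2 +
        (Pi.single t (j - ∑ t', s t') : Fin (m + 1) → Bits (3 + e)) (w i).2.2))
      (fun r i => .inl ((w i).2.1, fun j => (w i).2.1 ⬝ᵥ r j))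
    rw [Finset.sum_comm, mul_left_comm]
    refine (Finset.sum_congr rfl fun r _ => ?_).trans_le guess_le
    exact Fintype.sum_equiv (Equiv.addLeft (∑ t', s t')) _ _ fun v => by simp [Seed.point]
  rw [← ENNReal.ofReal_pow (Real.exp_pos _).le, ← ENNReal.ofReal_mul (by positivity),
    ← ENNReal.ofReal_add (by norm_num) (by positivity),
    ENNReal.ofReal_le_ofReal_iff (by positivity)] at success_le
  have := exp_quarter_pow_mul_le (N := m + n) (Q := 2 ^ e) (by rw [pow_add] at hdmn; omega)
  linarith

section PairwiseIndependence

open scoped BigOperators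

theorem expect_sq_sum_le_of_expect_mul_eq_zero {α R : Type*} [Fintype α] [Fintype R]
    {h : α → R → ℝ} {M : ℝ} {s : α → Finset α} {q : ℕ} (abs_le : ∀ x r, |h x r| ≤ M)
    (card_le : ∀ x', (s x').card ≤ q) (orthogonal : ∀ x', ∀ x ∉ s x', 𝔼 r, h x r * h x' r = 0) :
    𝔼 r, (∑ x, h x r) ^ 2 ≤ q * Fintype.card α * M ^ 2 := by
  classical
  rcases isEmpty_or_nonempty R
  · simpa using by positivity
  have expect_mul_le : ∀ x x', 𝔼 r, h x r * h x' r ≤ M ^ 2 := fun x x' =>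
    Finset.expect_le Finset.univ_nonempty fun r _ => by
      calc h x r * h x' r ≤ |h x r| * |h x' r| := (le_abs_self _).trans (abs_mul _ _).le
        _ ≤ M ^ 2 := by
          rw [sq]
          exact mul_le_mul (abs_le x r) (abs_le x' r) (abs_nonneg _)
            ((abs_nonneg _).trans (abs_le x r))
  calc 𝔼 r, (∑ x, h x r) ^ 2 = ∑ x', ∑ x, 𝔼 r, h x r * h x' r := by
        simp only [sq, Finset.sum_mul_sum, Finset.expect_sum_comm]
        exact Finset.sum_comm
    _ ≤ ∑ x', ∑ x, if x ∈ s x' then M ^ 2 else 0 := by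
        refine Finset.sum_le_sum fun x' _ => Finset.sum_le_sum fun x _ => ?_
        split_ifs with hx
        exacts [expect_mul_le x x', (orthogonal x' x hx).le]
    _ = ∑ x', (s x').card * M ^ 2 := by simp
    _ ≤ ∑ _x' : α, q * M ^ 2 := by
        gcongr with x' _
        exact card_le x'
    _ = q * Fintype.card α * M ^ 2 := by simp; ring

variable {K I J : Type*} [Field K] [Fintype I]

theorem exists_dotProduct_eq_one_and_eq_zero {x x' : I → K} (hx : x ∉ Submodule.span K {x'}) :
    ∃ e : I → K, x ⬝ᵥ e = 1 ∧ x' ⬝ᵥ e = 0 := by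
  classical
  obtain ⟨f, hfx, hfx'⟩ := Submodule.exists_le_ker_of_notMem hx
  obtain ⟨v, rfl⟩ := (dotProductEquiv K I).surjective f
  replace hfx : v ⬝ᵥ x ≠ 0 := hfx
  replace hfx' : v ⬝ᵥ x' = 0 := hfx' (Submodule.mem_span_singleton_self x')
  refine ⟨(v ⬝ᵥ x)⁻¹ • v, ?_, ?_⟩
  · rw [dotProduct_smul, dotProduct_comm x, smul_eq_mul, inv_mul_cancel₀ hfx]
  · rw [dotProduct_smul, dotProduct_comm x', hfx', smul_zero]

variable [Fintype K] [Fintype J] [DecidableEq I] [DecidableEq J]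

theorem expect_dotProduct_mul_dotProduct {x x' : I → K} (hx : x ∉ Submodule.span K {x'})
    (f g : (J → K) → ℝ) :
    𝔼 r : J → I → K, f (fun j => x ⬝ᵥ r j) * g (fun j => x' ⬝ᵥ r j) =
      (𝔼 b, f b) * 𝔼 r : J → I → K, g (fun j => x' ⬝ᵥ r j) := by
  obtain ⟨e, hxe, hx'e⟩ := exists_dotProduct_eq_one_and_eq_zero hx
  let shift : (J → K) → J → I → K := fun b j => b j • e
  have shift_label : ∀ b (r : J → I → K),
      (fun j => x ⬝ᵥ (r + shift b) j) = (fun j => x ⬝ᵥ r j) + b := fun b r => by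
    ext j
    simp only [shift, Pi.add_apply, dotProduct_add, dotProduct_smul, hxe, smul_eq_mul, mul_one]
  have shift_label' : ∀ b (r : J → I → K),
      (fun j => x' ⬝ᵥ (r + shift b) j) = fun j => x' ⬝ᵥ r j := fun b r => by
    ext j
    simp only [shift, Pi.add_apply, dotProduct_add, dotProduct_smul, hx'e, smul_zero, add_zero]
  have expect_shift : ∀ b, 𝔼 r : J → I → K, f (fun j => x ⬝ᵥ r j) * g (fun j => x' ⬝ᵥ r j) =
      𝔼 r : J → I → K, f ((fun j => x ⬝ᵥ r j) + b) * g (fun j => x' ⬝ᵥ r j) := fun b =>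
    (Fintype.expect_equiv (Equiv.addRight (shift b)) _ _ fun r => by
      simp only [Equiv.coe_addRight, shift_label, shift_label']).symm
  calc 𝔼 r : J → I → K, f (fun j => x ⬝ᵥ r j) * g (fun j => x' ⬝ᵥ r j)
      = 𝔼 b : J → K, 𝔼 r : J → I → K, f ((fun j => x ⬝ᵥ r j) + b) * g (fun j => x' ⬝ᵥ r j) := by
        simp only [← expect_shift, Fintype.expect_const]
    _ = 𝔼 r : J → I → K, (𝔼 b, f b) * g (fun j => x' ⬝ᵥ r j) := by
        rw [Finset.expect_comm]
        refine Finset.expect_congr rfl fun r _ => ?_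
        rw [← Finset.expect_mul]
        exact congrArg (· * _) (Fintype.expect_equiv (Equiv.addLeft _) _ _ fun _ => rfl)
    _ = _ := (Finset.mul_expect _ _ _).symm

/-- The labels `(x ⬝ᵥ r j)_j` of two points that are not proportional are independent, so that only
few covariances contribute to the variance of the sum over all points. -/
theorem expect_sq_sum_dotProduct_sub_le {F : (I → K) → (J → K) → ℝ} {M : ℝ}
    (nonneg : ∀ x b, 0 ≤ F x b) (le : ∀ x b, F x b ≤ M) :
    𝔼 r : J → I → K, (∑ x, F x (fun j => x ⬝ᵥ r j) -
        𝔼 r' : J → I → K, ∑ x, F x fun j => x ⬝ᵥ r' j) ^ 2 ≤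
      Fintype.card K * Fintype.card (I → K) * M ^ 2 := by
  classical
  set mean : (I → K) → ℝ := fun x => 𝔼 r : J → I → K, F x fun j => x ⬝ᵥ r j with mean_def
  have mean_nonneg : ∀ x, 0 ≤ mean x := fun x => Finset.expect_nonneg fun _ _ => nonneg _ _
  have mean_le : ∀ x, mean x ≤ M := fun x =>
    Finset.expect_le Finset.univ_nonempty fun _ _ => le _ _
  have orthogonal : ∀ x', ∀ x ∉ Finset.univ.image fun a : K => a • x',
      𝔼 r : J → I → K, (F x (fun j => x ⬝ᵥ r j) - mean x) *
        (F x' (fun j => x' ⬝ᵥ r j) - mean x') = 0 := by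
    intro x' x hx
    have hx : x ∉ Submodule.span K {x'} := by
      simpa [Submodule.mem_span_singleton] using hx
    have centred := expect_dotProduct_mul_dotProduct (J := J) hx (fun b => F x b - mean x) 1
    simp only [Pi.one_apply, mul_one, Finset.expect_sub_distrib, Fintype.expect_const,
      mean_def, sub_self] at centred
    rw [expect_dotProduct_mul_dotProduct hx (fun b => F x b - mean x)
      (fun b => F x' b - mean x'), Finset.expect_sub_distrib, Fintype.expect_const, mean_def,
      ← centred, zero_mul]
  simp only [Finset.expect_sum_comm, ← Finset.sum_sub_distrib]
  exact expect_sq_sum_le_of_expect_mul_eq_zero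
    (fun x r => abs_sub_le_of_nonneg_of_le (nonneg _ _) (le _ _) (mean_nonneg x) (mean_le x))
    (fun x' => Finset.card_image_le) orthogonal

end PairwiseIndependence

section ProductConcentration

open scoped BigOperators

variable {ι : Type*}

theorem one_sub_sum_le_prod {s : Finset ι} {f a : ι → ℝ} (hf : ∀ i, 0 ≤ f i) (ha : ∀ i, 0 ≤ a i)
    (h : ∀ i, 1 - a i ≤ f i) : 1 - ∑ i ∈ s, a i ≤ ∏ i ∈ s, f i := by
  classical
  induction s using Finset.induction_on with
  | empty => simp
  | insert i s hi ih =>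
    rw [Finset.sum_insert hi, Finset.prod_insert hi]
    have sum_nonneg : 0 ≤ ∑ i ∈ s, a i := Finset.sum_nonneg fun i _ => ha i
    have prod_nonneg : 0 ≤ ∏ i ∈ s, f i := Finset.prod_nonneg fun i _ => hf i
    rcases le_or_gt (1 - (a i + ∑ i ∈ s, a i)) 0 with nonpos | pos
    · exact nonpos.trans (mul_nonneg (hf i) prod_nonneg)
    · calc 1 - (a i + ∑ i ∈ s, a i) ≤ (1 - a i) * (1 - ∑ i ∈ s, a i) := by
            linarith [mul_nonneg (ha i) sum_nonneg]
        _ ≤ f i * ∏ i ∈ s, f i := mul_le_mul (h i) ih (by linarith [ha i]) (hf i)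

theorem prod_mul_one_sub_sum_le_prod [Fintype ι] {f g : ι → ℝ} (hf : ∀ i, 0 < f i)
    (hg : ∀ i, 0 ≤ g i) {q : ℝ} (hq : 0 < q) :
    (∏ i, f i) * (1 - ∑ i, (1 / (8 * q) + 2 * q * ((g i - f i) ^ 2 / f i ^ 2))) ≤ ∏ i, g i := by
  have one_sub_le : ∀ i, 1 - (1 / (8 * q) + 2 * q * ((g i - f i) ^ 2 / f i ^ 2)) ≤
      g i / f i := by
    intro i
    -- AM-GM: `t ≤ 1 / (8 q) + 2 q t²` for `t = 1 - g i / f i`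
    have sq_eq : 1 / (8 * q) + 2 * q * ((g i - f i) ^ 2 / f i ^ 2) - (1 - g i / f i) =
        2 * q * (1 - g i / f i - 1 / (4 * q)) ^ 2 := by
      field_simp [(hf i).ne']
      ring
    have : 0 ≤ 2 * q * (1 - g i / f i - 1 / (4 * q)) ^ 2 := by positivity
    linarith
  have prod_ge := one_sub_sum_le_prod (s := Finset.univ) (fun i => div_nonneg (hg i) (hf i).le)
    (fun i => by positivity) one_sub_le
  rwa [Finset.prod_div_distrib, le_div_iff₀' (Finset.prod_pos fun i _ => hf i)] at prod_ge

theorem le_expect_prod_of_expect_sq_sub_le [Fintype ι] {R : Type*} [Fintype R] [Nonempty R]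
    [DecidableEq R] {g : R → ι → ℝ} {f : ι → ℝ} (hg : ∀ r i, 0 ≤ g r i) (hf : ∀ i, 0 < f i)
    {δ : ℝ} (hδ₀ : 0 ≤ δ) (hδ : 16 * (Fintype.card ι + 1) ^ 2 * δ ≤ 1)
    (variance_le : ∀ i, 𝔼 r, (g r i - f i) ^ 2 ≤ δ * f i ^ 2) {bad : Finset R}
    (hbad : 8 * bad.card ≤ Fintype.card R) :
    5 / 8 * ∏ i, f i ≤ 𝔼 r, if r ∈ bad then 0 else ∏ i, g r i := by
  set q : ℝ := Fintype.card ι + 1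
  have hq : 0 < q := by positivity
  set a : R → ι → ℝ := fun r i => 1 / (8 * q) + 2 * q * ((g r i - f i) ^ 2 / f i ^ 2) with a_def
  have expect_a_le : ∀ i, 𝔼 r, a r i ≤ 1 / (8 * q) + 2 * q * δ := by
    intro i
    have hfi := hf i
    simp only [a_def, Finset.expect_add_distrib, Fintype.expect_const, ← Finset.mul_expect,
      ← Finset.expect_div]
    gcongr
    exact (div_le_iff₀ (by positivity)).2 (variance_le i)
  have expect_sum_a_le : 𝔼 r, ∑ i, a r i ≤ 1 / 4 := by
    rw [Finset.expect_sum_comm]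
    calc ∑ i, 𝔼 r, a r i ≤ ∑ _i : ι, (1 / (8 * q) + 2 * q * δ) :=
          Finset.sum_le_sum fun i _ => expect_a_le i
      _ ≤ q * (1 / (8 * q) + 2 * q * δ) := by
          rw [Finset.sum_const, Finset.card_univ, nsmul_eq_mul]
          gcongr
          exact le_add_of_nonneg_right zero_le_one
      _ = 1 / 8 + 16 * q ^ 2 * δ / 8 := by field_simp; ring
      _ ≤ 1 / 4 := by linarith
  have expect_bad_le : (𝔼 r, if r ∈ bad then 1 else 0 : ℝ) ≤ 1 / 8 := by
    rw [Fintype.expect_eq_sum_div_card, Finset.sum_boole, Finset.filter_mem_eq_inter,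
      Finset.univ_inter, div_le_iff₀ (by exact_mod_cast Fintype.card_pos)]
    have : (8 * bad.card : ℝ) ≤ Fintype.card R := by exact_mod_cast hbad
    linarith
  have prod_nonneg : 0 ≤ ∏ i, f i := Finset.prod_nonneg fun i _ => (hf i).le
  calc 5 / 8 * ∏ i, f i
      ≤ (∏ i, f i) * (1 - (𝔼 r, if r ∈ bad then 1 else 0) - 𝔼 r, ∑ i, a r i) := by
        rw [mul_comm]
        gcongr
        linarith
    _ = 𝔼 r, (∏ i, f i) * (1 - (if r ∈ bad then 1 else 0) - ∑ i, a r i) := by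
        simp only [← Finset.mul_expect, Finset.expect_sub_distrib, Fintype.expect_const]
    _ ≤ _ := Finset.expect_le_expect fun r _ => by
        split_ifs
        · have : 0 ≤ ∑ i, a r i := Finset.sum_nonneg fun i _ => by positivity
          exact mul_nonpos_of_nonneg_of_nonpos prod_nonneg (by linarith)
        · simpa only [sub_zero] using prod_mul_one_sub_sum_le_prod hf (hg r) hq

end ProductConcentration

section AverageLaw

open scoped BigOperators

theorem sum_pmf_mul_ne_top {α : Type*} [Fintype α] (p : PMF α) {G : α → ℝ≥0∞}
    (hG : ∀ a, G a ≠ ∞) : ∑ a, p a * G a ≠ ∞ :=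
  ENNReal.sum_ne_top.2 fun a _ => ENNReal.mul_ne_top (p.apply_ne_top a) (hG a)

theorem le_mul_sum_pmf_mul {α : Type*} [Fintype α] (p : PMF α) {G : α → ℝ≥0∞} {K : ℝ≥0∞}
    (hG : ∀ a a', G a ≤ K * G a') (a : α) : G a ≤ K * ∑ a', p a' * G a' := by
  calc G a = ∑ a', p a' * G a := by rw [← Finset.sum_mul, sum_pmf_eq_one, one_mul]
    _ ≤ ∑ a', p a' * (K * G a') := by
        gcongr with a' _
        exact hG a a'
    _ = K * ∑ a', p a' * G a' := by simp only [mul_left_comm, Finset.mul_sum]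

variable {c d k : ℕ}

/-- The law of a sample when the strings are uniformly random and the shares are `s`. -/
noncomputable def averageLaw (c : ℕ) (s : Fin (k + 1) → Bits d) : PMF (Point c d (k + 1)) :=
  (PMF.uniformOfFintype (Bits d → Bits c)).bind fun r => sampleLaw r s

theorem toReal_sum_averageLaw_mul (s : Fin (k + 1) → Bits d) {G : Point c d (k + 1) → ℝ≥0∞}
    (hG : ∀ z, G z ≠ ∞) :
    (∑ z, averageLaw c s z * G z).toReal =
      𝔼 r : Bits d → Bits c, (∑ z, sampleLaw r s z * G z).toReal := by
  rw [averageLaw, sum_pmf_bind_mul, sum_uniformOfFintype_mul, ENNReal.toReal_mul,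
    ENNReal.toReal_inv, ENNReal.toReal_natCast,
    ENNReal.toReal_sum fun r _ => sum_pmf_mul_ne_top (sampleLaw r s) hG,
    Fintype.expect_eq_sum_div_card, div_eq_inv_mul]

theorem toReal_sum_sampleLaw_mul (r : Bits d → Bits c) (s : Fin (k + 1) → Bits d)
    {G : Point c d (k + 1) → ℝ≥0∞} (hG : ∀ z, G z ≠ ∞) :
    (∑ z, sampleLaw r s z * G z).toReal =
      2⁻¹ * ((2 ^ c)⁻¹ * ∑ x, (G (.inl (x, fun j => x ⬝ᵥ r j))).toReal) +
      2⁻¹ * ((k + 1 : ℝ)⁻¹ * ∑ t, (G (.inr (t, s t))).toReal) := by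
  have sum_inl_ne_top : ∑ x, G (.inl (x, fun j => x ⬝ᵥ r j)) ≠ ∞ :=
    ENNReal.sum_ne_top.2 fun x _ => hG _
  have sum_inr_ne_top : ∑ t, G (.inr (t, s t)) ≠ ∞ := ENNReal.sum_ne_top.2 fun t _ => hG _
  rw [sum_sampleLaw_mul, ENNReal.toReal_add (by finiteness) (by finiteness)]
  simp only [ENNReal.toReal_mul, ENNReal.toReal_inv, ENNReal.toReal_pow, ENNReal.toReal_ofNat,
    ENNReal.toReal_sum fun _ _ => hG _]
  norm_cast

theorem expect_sq_sum_sampleLaw_mul_sub_le (s : Fin (k + 1) → Bits d)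
    {G : Point c d (k + 1) → ℝ≥0∞} (hG : ∀ z, G z ≠ ∞) {M : ℝ} (hM : ∀ z, (G z).toReal ≤ M) :
    𝔼 r : Bits d → Bits c, ((∑ z, sampleLaw r s z * G z).toReal -
        (∑ z, averageLaw c s z * G z).toReal) ^ 2 ≤ (2 * 2 ^ c)⁻¹ * M ^ 2 := by
  have sub_eq : ∀ r : Bits d → Bits c, (∑ z, sampleLaw r s z * G z).toReal -
      (∑ z, averageLaw c s z * G z).toReal =
        (2 * 2 ^ c)⁻¹ * (∑ x, (G (.inl (x, fun j => x ⬝ᵥ r j))).toReal -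
          𝔼 r' : Bits d → Bits c, ∑ x, (G (.inl (x, fun j => x ⬝ᵥ r' j))).toReal) := by
    intro r
    simp only [toReal_sum_averageLaw_mul s hG, toReal_sum_sampleLaw_mul _ s hG,
      Finset.expect_add_distrib, ← Finset.mul_expect, Fintype.expect_const]
    ring
  have variance_le := expect_sq_sum_dotProduct_sub_le (K := ZMod 2) (I := Fin c) (J := Bits d)
    (F := fun x b => (G (.inl (x, b))).toReal) (fun _ _ => ENNReal.toReal_nonneg)
    fun _ _ => hM _
  have card_eq : (Fintype.card (ZMod 2) * Fintype.card (Fin c → ZMod 2) : ℝ) = 2 * 2 ^ c := by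
    simp
  rw [card_eq] at variance_le
  simp only [sub_eq, mul_pow, ← Finset.mul_expect]
  calc _ ≤ ((2 * 2 ^ c : ℝ)⁻¹) ^ 2 * (2 * 2 ^ c * M ^ 2) := by gcongr
    _ = (2 * 2 ^ c)⁻¹ * M ^ 2 := by field_simp

theorem expect_sq_sum_sampleLaw_mul_sub_le_of_private (s : Fin (k + 1) → Bits d)
    {G : Point c d (k + 1) → ℝ≥0∞} (hG : ∀ z, G z ≠ ∞)
    (hdp : ∀ z z', G z ≤ ENNReal.ofReal (Real.exp (1 / 4)) * G z') :
    𝔼 r : Bits d → Bits c, ((∑ z, sampleLaw r s z * G z).toReal -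
        (∑ z, averageLaw c s z * G z).toReal) ^ 2 ≤
      (2 ^ c)⁻¹ * (∑ z, averageLaw c s z * G z).toReal ^ 2 := by
  set g := (∑ z, averageLaw c s z * G z).toReal
  have toReal_le : ∀ z, (G z).toReal ≤ 4 / 3 * g := fun z => by
    have := ENNReal.toReal_mono
      (ENNReal.mul_ne_top ENNReal.ofReal_ne_top (sum_pmf_mul_ne_top (averageLaw c s) hG))
      (le_mul_sum_pmf_mul (averageLaw c s) hdp z)
    rw [ENNReal.toReal_mul, ENNReal.toReal_ofReal (Real.exp_pos _).le] at this
    grw [this, exp_quarter_le]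
  calc _ ≤ (2 * 2 ^ c)⁻¹ * (4 / 3 * g) ^ 2 := expect_sq_sum_sampleLaw_mul_sub_le s hG toReal_le
    _ = 8 / 9 * ((2 ^ c)⁻¹ * g ^ 2) := by field_simp; ring
    _ ≤ (2 ^ c)⁻¹ * g ^ 2 := mul_le_of_le_one_left (by positivity) (by norm_num)

theorem eight_mul_card_filter_apply_eq_le {J V : Type*} [Fintype J] [DecidableEq J] [Fintype V]
    [DecidableEq V] (hV : 8 ≤ Fintype.card V) (j : J) (o : V) :
    8 * (Finset.univ.filter fun r : J → V => r j = o).card ≤ Fintype.card (J → V) := by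
  have card_filter := Fintype.card_filter_piFinset_const_eq_of_mem
    (Finset.univ : Finset V) j (Finset.mem_univ o)
  rw [Fintype.piFinset_univ] at card_filter
  rw [card_filter, Fintype.card_fun, ← Finset.card_univ (α := V),
    ← Nat.sub_add_cancel (Fintype.card_pos_iff.2 ⟨j⟩ : 1 ≤ Fintype.card J), pow_succ,
    Nat.add_sub_cancel, mul_comm]
  exact Nat.mul_le_mul_left _ hV

theorem card_mul_prod_sum_averageLaw_mul_le {ι : Type*} [Fintype ι]
    (hι : 16 * (Fintype.card ι + 1) ^ 2 ≤ 2 ^ c) (s : Fin (k + 1) → Bits d)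
    {G : ι → Point c d (k + 1) → ℝ≥0∞} (hG : ∀ i z, G i z ≠ ∞)
    (hdp : ∀ i z z', G i z ≤ ENNReal.ofReal (Real.exp (1 / 4)) * G i z') (o : Bits c)
    (j : Bits d) :
    Fintype.card (Bits d → Bits c) * (ENNReal.ofReal (5 / 8) *
        ∏ i, ∑ z, averageLaw c s z * G i z) ≤
      ∑ r : Bits d → Bits c, if r j = o then 0 else ∏ i, ∑ z, sampleLaw r s z * G i z := by
  classical
  have average_ne_top : ∀ i, ∑ z, averageLaw c s z * G i z ≠ ∞ := fun i =>
    sum_pmf_mul_ne_top _ (hG i)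
  have sample_ne_top : ∀ r i, ∑ z, sampleLaw r s z * G i z ≠ ∞ := fun r i =>
    sum_pmf_mul_ne_top _ (hG i)
  by_cases exists_eq_zero : ∃ i, ∑ z, averageLaw c s z * G i z = 0
  · obtain ⟨i, hi⟩ := exists_eq_zero
    rw [Finset.prod_eq_zero (Finset.mem_univ i) hi, mul_zero, mul_zero]
    exact zero_le
  push Not at exists_eq_zero
  have hι' : (16 * (Fintype.card ι + 1) ^ 2 : ℝ) ≤ 2 ^ c := by exact_mod_cast hι
  have eight_le_card : 8 ≤ Fintype.card (Bits c) := by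
    have card_eq : Fintype.card (Bits c) = 2 ^ c := by simp
    have one_le_sq := Nat.one_le_pow 2 (Fintype.card ι + 1) (Nat.succ_pos _)
    linarith
  have toReal_le := le_expect_prod_of_expect_sq_sub_le (δ := (2 ^ c)⁻¹)
    (fun (r : Bits d → Bits c) i => ENNReal.toReal_nonneg (a := ∑ z, sampleLaw r s z * G i z))
    (fun i => ENNReal.toReal_pos (exists_eq_zero i) (average_ne_top i)) (by positivity)
    (by rwa [mul_inv_le_iff₀ (by positivity), one_mul])
    (fun i => expect_sq_sum_sampleLaw_mul_sub_le_of_private s (hG i) (hdp i))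
    (eight_mul_card_filter_apply_eq_le eight_le_card j o)
  rw [Fintype.expect_eq_sum_div_card, le_div_iff₀' (by positivity)] at toReal_le
  simp only [Finset.mem_filter, Finset.mem_univ, true_and, ← ENNReal.toReal_prod,
    ← ENNReal.toReal_zero, ← apply_ite ENNReal.toReal] at toReal_le
  have prod_average_ne_top : ∏ i, ∑ z, averageLaw c s z * G i z ≠ ∞ :=
    ENNReal.prod_ne_top fun i _ => average_ne_top i
  have ite_prod_ne_top : ∀ r : Bits d → Bits c,
      (if r j = o then 0 else ∏ i, ∑ z, sampleLaw r s z * G i z) ≠ ∞ := fun r => by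
    split_ifs
    exacts [ENNReal.zero_ne_top, ENNReal.prod_ne_top fun i _ => sample_ne_top r i]
  rw [← ENNReal.toReal_sum fun r _ => ite_prod_ne_top r] at toReal_le
  rw [← ENNReal.toReal_le_toReal (by finiteness)
    (ENNReal.sum_ne_top.2 fun r _ => ite_prod_ne_top r), ENNReal.toReal_mul, ENNReal.toReal_mul,
    ENNReal.toReal_natCast, ENNReal.toReal_ofReal (by norm_num)]
  exact toReal_le

end AverageLaw

namespace Protocol

variable {X Y : Type} {σ : List Round} {m n : ℕ}

/-- The probability `viewProb` of a view of the referee, averaged over independent inputs of the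
agents with law `p`. -/
noncomputable def averageViewProb [Fintype X] (P : Protocol X Y σ m n) (ρ : P.RefCoins)
    (x : Fin m → X) (p : PMF X) (B : P.View) : ℝ≥0∞ :=
  P.curator.law (P.curator.consistentCoins x (P.curatorLog ρ B)) *
    ∏ i, ∑ z, p z * (P.agent i).law ((P.agent i).consistentCoins (fun _ => z) (P.agentLog ρ i B))

variable [Fintype X]

open Classical in
theorem sum_prod_mul_partyLaw_revRun (P : Protocol X Y σ m n) (ρ : P.RefCoins) (x : Fin m → X)
    (p : PMF X) (τ : List Round) (q : P.View → Prop) :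
    ∑ y : Fin n → X, (∏ i, p (y i)) * P.partyLaw {ω | q (P.revRun x y (ρ, ω) τ)} =
      ∑' B : P.View, if P.shape B = τ ∧ q B then P.averageViewProb ρ x p B else 0 := by
  simp only [partyLaw_revRun, ← ENNReal.tsum_mul_left, mul_ite, mul_zero]
  rw [← Summable.tsum_finsetSum fun _ _ => ENNReal.summable]
  refine tsum_congr fun B => ?_
  split_ifs
  · simp only [viewProb, averageViewProb, mul_left_comm _ (P.curator.law _), ← Finset.mul_sum]
    exact congrArg _ (sum_prod_mul_prod p fun i z =>
      (P.agent i).law ((P.agent i).consistentCoins (fun _ => z) (P.agentLog ρ i B)))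
  · simp only [Finset.sum_const_zero]

theorem tsum_averageViewProb (P : Protocol X Y σ m n) (ρ : P.RefCoins) (x : Fin m → X)
    (p : PMF X) (τ : List Round) :
    ∑' B : P.View, (if P.shape B = τ then P.averageViewProb ρ x p B else 0) = 1 := by
  classical
  have := P.sum_prod_mul_partyLaw_revRun ρ x p τ fun _ => True
  simpa [sum_prod_pmf_eq_one] using this.symm

theorem sum_prod_mul_partyLaw_revRun_add_compl (P : Protocol X Y σ m n) (ρ : P.RefCoins)
    (x : Fin m → X) (p : PMF X) (τ : List Round) (q : P.View → Prop) :
    ∑ y : Fin n → X, (∏ i, p (y i)) * P.partyLaw {ω | q (P.revRun x y (ρ, ω) τ)} +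
      ∑ y : Fin n → X, (∏ i, p (y i)) * P.partyLaw {ω | ¬ q (P.revRun x y (ρ, ω) τ)} = 1 := by
  classical
  rw [P.sum_prod_mul_partyLaw_revRun ρ x p τ q, P.sum_prod_mul_partyLaw_revRun ρ x p τ (¬ q ·),
    ← ENNReal.tsum_add, ← P.tsum_averageViewProb ρ x p τ]
  refine tsum_congr fun B => ?_
  by_cases P.shape B = τ <;> by_cases q B <;> simp [*]

end Protocol

section LocalModel

variable {c d k m n : ℕ} {σ : List Round} {P : Protocol (Point c d (k + 1)) (Bits c) σ m n}

/-- The probability of a transcript is a product over the agents; by privacy each factor is nearly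
the same for most choices of the strings, whereas a guess from the transcript is wrong for most. -/
theorem Protocol.IsPrivate.le_sum_partyLaw_guess_ne (hP : P.IsPrivate (1 / 4))
    (hn : 16 * (n + 1) ^ 2 ≤ 2 ^ c) (ρ : P.RefCoins) (x : Fin m → Point c d (k + 1))
    (s : Fin (k + 1) → Bits d) (j : Bits d) (guess : P.View → Bits c) :
    Fintype.card (Bits d → Bits c) * ENNReal.ofReal (5 / 8) ≤
      ∑ r : Bits d → Bits c, ∑ y : Fin n → Point c d (k + 1), (∏ i, sampleLaw r s (y i)) *
        P.partyLaw {ω | ¬ r j = guess (P.revRun x y (ρ, ω) σ.reverse)} := by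
  classical
  have view_le : ∀ B, P.shape B = σ.reverse →
      Fintype.card (Bits d → Bits c) *
          (ENNReal.ofReal (5 / 8) * P.averageViewProb ρ x (averageLaw c s) B) ≤
        ∑ r : Bits d → Bits c,
          if r j = guess B then 0 else P.averageViewProb ρ x (sampleLaw r s) B := by
    intro B hB
    have agents_le := card_mul_prod_sum_averageLaw_mul_le (ι := Fin n)
      (G := fun i z => (P.agent i).law
        ((P.agent i).consistentCoins (fun _ => z) (P.agentLog ρ i B)))
      (by simpa using hn) s (fun _ _ => measure_ne_top _ _) (fun i z z' =>
        (hP.2 i).law_consistentCoins_le (x := fun _ => z) (x' := fun _ => z')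
          (Or.inr ⟨0, fun i hi => (hi (Subsingleton.elim _ _)).elim⟩)
          (by rw [P.length_agentLog, hB, List.count_reverse])) (guess B) j
    simp only [Protocol.averageViewProb, mul_left_comm _ (P.curator.law _)]
    calc _ ≤ _ := mul_le_mul_right agents_le _
      _ = _ := by simp only [Finset.mul_sum, mul_ite, mul_zero]
  calc Fintype.card (Bits d → Bits c) * ENNReal.ofReal (5 / 8)
      = ∑' B : P.View, if P.shape B = σ.reverse then Fintype.card (Bits d → Bits c) *
          (ENNReal.ofReal (5 / 8) * P.averageViewProb ρ x (averageLaw c s) B) else 0 := by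
        simp only [← mul_ite_zero, ENNReal.tsum_mul_left, P.tsum_averageViewProb, mul_one]
    _ ≤ ∑' B : P.View, ∑ r : Bits d → Bits c,
          if P.shape B = σ.reverse ∧ ¬ r j = guess B then
            P.averageViewProb ρ x (sampleLaw r s) B else 0 := by
        refine ENNReal.tsum_le_tsum fun B => ?_
        split_ifs with hB
        · refine (view_le B hB).trans_eq (Finset.sum_congr rfl fun r _ => ?_)
          simp only [hB, true_and, ite_not]
        · exact zero_le
    _ = _ := by
        rw [Summable.tsum_finsetSum fun _ _ => ENNReal.summable]
        refine Finset.sum_congr rfl fun r _ => ?_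
        rw [P.sum_prod_mul_partyLaw_revRun ρ x (sampleLaw r s) σ.reverse fun B => ¬ r j = guess B]
        congr!

theorem Protocol.IsPrivate.sum_partyLaw_guess_eq_le (hP : P.IsPrivate (1 / 4))
    (hn : 16 * (n + 1) ^ 2 ≤ 2 ^ c) (ρ : P.RefCoins) (x : Fin m → Point c d (k + 1))
    (s : Fin (k + 1) → Bits d) (j : Bits d) (guess : P.View → Bits c) :
    ∑ r : Bits d → Bits c, ∑ y : Fin n → Point c d (k + 1), (∏ i, sampleLaw r s (y i)) *
        P.partyLaw {ω | r j = guess (P.revRun x y (ρ, ω) σ.reverse)} ≤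
      Fintype.card (Bits d → Bits c) * ENNReal.ofReal (3 / 8) := by
  have ne_top : Fintype.card (Bits d → Bits c) * ENNReal.ofReal (5 / 8) ≠ ∞ := by finiteness
  refine (ENNReal.add_le_add_iff_right ne_top).1 ?_
  calc _ ≤ _ := add_le_add_right (hP.le_sum_partyLaw_guess_ne hn ρ x s j guess) _
    _ = ∑ _r : Bits d → Bits c, 1 := by
        rw [← Finset.sum_add_distrib]
        exact Finset.sum_congr rfl fun r _ => P.sum_prod_mul_partyLaw_revRun_add_compl ρ x
          (sampleLaw r s) σ.reverse fun B => r j = guess B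
    _ = _ := by
        rw [← mul_add, ← ENNReal.ofReal_add (by norm_num) (by norm_num)]
        norm_num

theorem Protocol.IsPrivate.sum_outputProb_le (hP : P.IsPrivate (1 / 4))
    (hn : 16 * (n + 1) ^ 2 ≤ 2 ^ c) (x : Fin m → Point c d (k + 1))
    (s : Fin (k + 1) → Bits d) (j : Bits d) :
    ∑ r : Bits d → Bits c, ∑ y : Fin n → Point c d (k + 1), (∏ i, sampleLaw r s (y i)) *
        P.outputProb x y (r j) ≤
      Fintype.card (Bits d → Bits c) * ENNReal.ofReal (3 / 8) := by
  calc ∑ r : Bits d → Bits c, ∑ y : Fin n → Point c d (k + 1), (∏ i, sampleLaw r s (y i)) *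
        P.outputProb x y (r j)
      ≤ ∑ r : Bits d → Bits c, ∑ y : Fin n → Point c d (k + 1), ∫⁻ ρ,
          (∏ i, sampleLaw r s (y i)) * P.partyLaw {ω | P.result x y (ρ, ω) = r j} ∂P.refLaw := by
        gcongr with r _ y _
        rw [P.outputProb_eq_lintegral]
        exact lintegral_const_mul_le _ _
    _ ≤ ∫⁻ ρ, ∑ r : Bits d → Bits c, ∑ y : Fin n → Point c d (k + 1),
          (∏ i, sampleLaw r s (y i)) * P.partyLaw {ω | P.result x y (ρ, ω) = r j} ∂P.refLaw := by
        grw [Finset.sum_le_sum fun r _ => sum_lintegral_le_lintegral_sum _ _ _,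
          sum_lintegral_le_lintegral_sum]
    _ ≤ ∫⁻ _ρ, Fintype.card (Bits d → Bits c) * ENNReal.ofReal (3 / 8) ∂P.refLaw := by
        refine lintegral_mono fun ρ => ?_
        simpa only [Protocol.result_eq_output_revRun, eq_comm] using
          hP.sum_partyLaw_guess_eq_le hn ρ x s j fun B => P.output ρ B.reverse
    _ = _ := by simp

theorem two_pow_lt_of_local {P : Protocol (Point c d (k + 1)) (Bits c) σ 0 n}
    (hP : P.IsPrivate (1 / 4)) (hsol : SolvesOneOutOfParity P (1 / 4)) :
    2 ^ c < 16 * (n + 1) ^ 2 := by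
  by_contra! hn
  have card_mul_le : Fintype.card (Bits d → Bits c) * ENNReal.ofReal (1 - 1 / 4) ≤
      Fintype.card (Bits d → Bits c) * ENNReal.ofReal (3 / 8) := by
    calc Fintype.card (Bits d → Bits c) * ENNReal.ofReal (1 - 1 / 4)
        = ∑ _r : Bits d → Bits c, ENNReal.ofReal (1 - 1 / 4) := by simp
      _ ≤ ∑ r : Bits d → Bits c, ∑ y : Fin n → Point c d (k + 1),
            (∏ i, sampleLaw r 0 (y i)) * P.outputProb default y (r (∑ _t : Fin (k + 1), 0)) := by
          refine Finset.sum_le_sum fun r _ => (hsol r 0).trans_eq ?_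
          simp only [Finset.univ_unique, Finset.sum_singleton, Finset.univ_eq_empty,
            Finset.prod_empty, one_mul]
          congr!
      _ ≤ _ := hP.sum_outputProb_le hn default 0 (∑ _t : Fin (k + 1), 0)
  rw [ENNReal.mul_le_mul_iff_right (by simp) (by simp),
    ENNReal.ofReal_le_ofReal_iff (by norm_num)] at card_mul_le
  norm_num at card_mul_le

end LocalModel

section Kernel

variable {X Q Msg : Type} {ℓ : ℕ}

theorem Adversary.outputProb_one [Countable Msg] (A : Adversary Msg) (P : Party X ℓ Msg)
    (x : Fin ℓ → X) {S : Set A.Out} (hS : MeasurableSet S) :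
    A.outputProb P 1 x S = ∑' v : Msg × Msg,
      A.law ({a | A.query a [] = v.1} ∩ (fun a => A.output a [v.2]) ⁻¹' S) *
        P.law {ω | P.reply x ω [v.1] = v.2} := by
  have outputs_eq_iUnion :
      {ω : A.Coins × P.Coins | A.output ω.1 (P.interact x ω.2 (A.query ω.1) 1).2 ∈ S} =
        ⋃ v : Msg × Msg, ({a | A.query a [] = v.1} ∩ (fun a => A.output a [v.2]) ⁻¹' S) ×ˢ
          {ω | P.reply x ω [v.1] = v.2} := by
    ext ω
    simp [Party.interact, and_assoc]
  rw [Adversary.outputProb, outputs_eq_iUnion, measure_iUnion]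
  · exact tsum_congr fun v => Measure.prod_prod _ _
  · rintro ⟨q, w⟩ ⟨q', w'⟩ hne
    refine Set.disjoint_left.2 ?_
    rintro ω ⟨⟨(hq : _ = q), -⟩, (hw : _ = w)⟩ ⟨⟨(hq' : _ = q'), -⟩, (hw' : _ = w')⟩
    have q_eq : q = q' := hq.symm.trans hq'
    have w_eq : w = w' := by rw [← hw, ← hw', q_eq]
    exact hne (Prod.ext q_eq w_eq)
  · exact fun v => ((A.measurableSet_query _ _).inter (A.measurable_output _ hS)).prod
      (P.measurableSet_reply _ _ _)

theorem Party.isPrivate_one_of_law_reply_le [Countable Msg] {P : Party X ℓ Msg} {ε : ℝ}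
    (h : ∀ x x', Neighboring x x' → ∀ q w, P.law {ω | P.reply x ω [q] = w} ≤
      ENNReal.ofReal (Real.exp ε) * P.law {ω | P.reply x' ω [q] = w}) : P.IsPrivate 1 ε := by
  intro A x x' hx S hS
  simp only [A.outputProb_one P _ hS, ← ENNReal.tsum_mul_left]
  refine ENNReal.tsum_le_tsum fun v => ?_
  rw [mul_left_comm]
  gcongr
  exact h x x' hx _ _

/-- The party that on input `x` and messages `h` answers with a sample from `κ x (f h)`; its coins
are independent samples for all arguments of `κ`. -/
noncomputable def Party.ofKernel (κ : (Fin ℓ → X) → Q → PMF Msg) (f : List Msg → Q) :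
    Party X ℓ Msg :=
  letI : MeasurableSpace Msg := ⊤
  { Coins := (Fin ℓ → X) × Q → Msg
    law := Measure.infinitePi fun p => (κ p.1 p.2).toMeasure
    reply := fun x ω h => ω (x, f h)
    measurableSet_reply := fun x h w =>
      have measurableSet_singleton : MeasurableSet {w} := MeasurableSpace.measurableSet_top
      measurable_pi_apply (X := fun _ : (Fin ℓ → X) × Q => Msg) (x, f h)
        measurableSet_singleton }

theorem Party.law_reply_ofKernel (κ : (Fin ℓ → X) → Q → PMF Msg) (f : List Msg → Q)
    (x : Fin ℓ → X) (h : List Msg) (w : Msg) :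
    (Party.ofKernel κ f).law {ω | (Party.ofKernel κ f).reply x ω h = w} = κ x (f h) w := by
  let _ : MeasurableSpace Msg := ⊤
  have measurableSet_singleton : MeasurableSet {w} := MeasurableSpace.measurableSet_top
  have law_preimage := (measurePreserving_eval_infinitePi
    (fun p : (Fin ℓ → X) × Q => (κ p.1 p.2).toMeasure) (x, f h)).measure_preimage
      measurableSet_singleton.nullMeasurableSet
  exact law_preimage.trans (PMF.toMeasure_apply_singleton _ _ measurableSet_singleton)

theorem Party.ofKernel_isPrivate_one [Countable Msg] {κ : (Fin ℓ → X) → Q → PMF Msg} {ε : ℝ}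
    (hκ : ∀ x x', Neighboring x x' → ∀ q w,
      κ x q w ≤ ENNReal.ofReal (Real.exp ε) * κ x' q w) (f : List Msg → Q) :
    (Party.ofKernel κ f).IsPrivate 1 ε := by
  refine Party.isPrivate_one_of_law_reply_le fun x x' hx q w => ?_
  rw [Party.law_reply_ofKernel, Party.law_reply_ofKernel]
  exact hκ x x' hx _ w

theorem pmf_map_apply_le_mul {α β : Type*} {p q : PMF α} {K : ℝ≥0∞} (h : ∀ a, p a ≤ K * q a)
    (f : α → β) (b : β) : p.map f b ≤ K * q.map f b := by
  classical
  rw [PMF.map_apply, PMF.map_apply, ← ENNReal.tsum_mul_left]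
  refine ENNReal.tsum_le_tsum fun a => ?_
  split_ifs
  exacts [h a, zero_le]

theorem pmf_map_apply_of_injective {α β : Type*} (p : PMF α) {f : α → β}
    (hf : Function.Injective f) (a : α) : p.map f (f a) = p a := by
  classical
  simp [PMF.map_apply, hf.eq_iff]

end Kernel

section ExponentialMechanism

variable {V : Type*} [Fintype V] [Nonempty V]

/-- The exponential mechanism: the candidate `v` is chosen with probability proportional to
`exp (-η * loss v)`. -/
noncomputable def expMechanism (η : ℝ) (loss : V → ℝ) : PMF V :=
  PMF.normalize (fun v => ENNReal.ofReal (Real.exp (-η * loss v)))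
    (by simp [Real.exp_pos, not_le])
    (by simp [tsum_fintype, ENNReal.sum_eq_top])

theorem expMechanism_apply (η : ℝ) (loss : V → ℝ) (v : V) :
    expMechanism η loss v =
      ENNReal.ofReal (Real.exp (-η * loss v) / ∑ v', Real.exp (-η * loss v')) := by
  have sum_pos : 0 < ∑ v', Real.exp (-η * loss v') :=
    Finset.sum_pos (fun v' _ => Real.exp_pos _) Finset.univ_nonempty
  rw [expMechanism, PMF.normalize_apply, tsum_fintype,
    ← ENNReal.ofReal_sum_of_nonneg fun _ _ => (Real.exp_pos _).le,
    ← ENNReal.ofReal_inv_of_pos sum_pos, ← ENNReal.ofReal_mul (Real.exp_pos _).le, div_eq_mul_inv]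

theorem expMechanism_le {η Δ : ℝ} (hη : 0 ≤ η) {loss loss' : V → ℝ}
    (h : ∀ v, |loss v - loss' v| ≤ Δ) (v : V) :
    expMechanism η loss v ≤
      ENNReal.ofReal (Real.exp (2 * η * Δ)) * expMechanism η loss' v := by
  have weight_le : ∀ v,
      Real.exp (-η * loss v) ≤ Real.exp (η * Δ) * Real.exp (-η * loss' v) := fun v => by
    rw [← Real.exp_add, Real.exp_le_exp]
    nlinarith [(abs_le.1 (h v)).1]
  have sum_le : ∑ v, Real.exp (-η * loss' v) ≤
      Real.exp (η * Δ) * ∑ v, Real.exp (-η * loss v) := by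
    rw [Finset.mul_sum]
    gcongr with v _
    rw [← Real.exp_add, Real.exp_le_exp]
    nlinarith [(abs_le.1 (h v)).2]
  have : ∀ l : V → ℝ, 0 < ∑ v, Real.exp (-η * l v) := fun l =>
    Finset.sum_pos (fun v _ => Real.exp_pos _) Finset.univ_nonempty
  rw [expMechanism_apply, expMechanism_apply, ← ENNReal.ofReal_mul (Real.exp_pos _).le]
  gcongr ENNReal.ofReal ?_
  calc Real.exp (-η * loss v) / ∑ v, Real.exp (-η * loss v)
      ≤ Real.exp (η * Δ) * Real.exp (-η * loss' v) /
          ((∑ v, Real.exp (-η * loss' v)) / Real.exp (η * Δ)) := by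
        gcongr
        · exact weight_le v
        · exact (div_le_iff₀' (Real.exp_pos _)).2 sum_le
    _ = Real.exp (2 * η * Δ) * (Real.exp (-η * loss' v) / ∑ v, Real.exp (-η * loss' v)) := by
        rw [mul_assoc 2, two_mul, Real.exp_add]
        field_simp

theorem one_le_expMechanism_add_sum [DecidableEq V] (η : ℝ) {loss : V → ℝ} {v : V}
    (hv : loss v = 0) :
    1 ≤ expMechanism η loss v +
      ∑ v' ∈ Finset.univ.erase v, ENNReal.ofReal (Real.exp (-η * loss v')) := by
  set a := ∑ v' ∈ Finset.univ.erase v, Real.exp (-η * loss v')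
  have a_nonneg : 0 ≤ a := Finset.sum_nonneg fun v' _ => (Real.exp_pos _).le
  have sum_eq : ∑ v', Real.exp (-η * loss v') = 1 + a := by
    rw [← Finset.add_sum_erase _ _ (Finset.mem_univ v), hv, mul_zero, Real.exp_zero]
  rw [expMechanism_apply, sum_eq, hv, mul_zero, Real.exp_zero,
    ← ENNReal.ofReal_sum_of_nonneg fun _ _ => (Real.exp_pos _).le,
    ← ENNReal.ofReal_add (by positivity) a_nonneg, ENNReal.one_le_ofReal,
    div_add' _ _ _ (by positivity), one_le_div (by positivity)]
  nlinarith

end ExponentialMechanism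

theorem Neighboring.symm {X : Type} {ℓ : ℕ} {x x' : Fin ℓ → X} (h : Neighboring x x') :
    Neighboring x' x :=
  h.imp Eq.symm fun ⟨i, hi⟩ => ⟨i, fun j hj => (hi j hj).symm⟩

theorem Neighboring.card_filter_le {X : Type} {ℓ : ℕ} {x x' : Fin ℓ → X} (h : Neighboring x x')
    (p : X → Prop) [DecidablePred p] :
    (Finset.univ.filter fun i => p (x i)).card ≤
      (Finset.univ.filter fun i => p (x' i)).card + 1 := by
  obtain rfl | ⟨i, hi⟩ := h
  · exact Nat.le_succ _
  · calc (Finset.univ.filter fun i => p (x i)).card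
        ≤ (insert i (Finset.univ.filter fun i => p (x' i))).card := by
          refine Finset.card_le_card fun l hl => ?_
          by_cases hli : l = i
          · exact Finset.mem_insert.2 (.inl hli)
          · simpa [hli, hi l hli] using hl
      _ ≤ _ := Finset.card_insert_le _ _

theorem Neighboring.abs_card_filter_sub_le_one {X : Type} {ℓ : ℕ} {x x' : Fin ℓ → X}
    (h : Neighboring x x') (p : X → Prop) [DecidablePred p] :
    |((Finset.univ.filter fun i => p (x i)).card : ℝ) -
      (Finset.univ.filter fun i => p (x' i)).card| ≤ 1 := by
  have card_le := h.card_filter_le p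
  have card_ge := h.symm.card_filter_le p
  rw [abs_sub_le_iff]
  constructor <;> rw [sub_le_iff_le_add'] <;> norm_cast

theorem card_mul_card_filter_dotProduct_eq {K ι : Type*} [Field K] [Fintype K] [DecidableEq K]
    [Fintype ι] [DecidableEq ι] {v : ι → K} (hv : v ≠ 0) (b : K) :
    Fintype.card K * (Finset.univ.filter fun x : ι → K => x ⬝ᵥ v = b).card =
      Fintype.card (ι → K) := by
  obtain ⟨i, hi⟩ := Function.ne_iff.1 hv
  have card_fiber_eq : ∀ b', (Finset.univ.filter fun x : ι → K => x ⬝ᵥ v = b').card =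
      (Finset.univ.filter fun x : ι → K => x ⬝ᵥ v = b).card := fun b' =>
    Finset.card_equiv (Equiv.addRight (Pi.single i ((b - b') / v i))) fun x => by
      simp only [Finset.mem_filter, Finset.mem_univ, true_and, Equiv.coe_addRight,
        add_dotProduct, single_dotProduct, div_mul_cancel₀ _ hi]
      constructor <;> intro h <;> linear_combination h
  calc _ = ∑ b', (Finset.univ.filter fun x : ι → K => x ⬝ᵥ v = b').card := by
        simp only [card_fiber_eq, Finset.sum_const, Finset.card_univ, smul_eq_mul]
    _ = Fintype.card (ι → K) :=
        (Finset.card_eq_sum_card_fiberwise fun _ _ => Finset.mem_coe.2 (Finset.mem_univ _)).symm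

section LearningParity

variable {c d k ℓ : ℕ}

/-- The sample contradicts the candidate `v` for the string with index `j`. -/
def Refutes (j : Bits d) (v : Bits c) : Point c d (k + 1) → Prop
  | .inl (x, b) => x ⬝ᵥ v ≠ b j
  | .inr _ => False

instance (j : Bits d) (v : Bits c) : DecidablePred (Refutes (k := k) j v)
  | .inl (x, b) => inferInstanceAs (Decidable (x ⬝ᵥ v ≠ b j))
  | .inr _ => inferInstanceAs (Decidable False)

@[simp]
theorem refutes_inl (j : Bits d) (v x : Bits c) (b : Bits d → ZMod 2) :
    Refutes (k := k) j v (.inl (x, b)) ↔ x ⬝ᵥ v ≠ b j :=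
  Iff.rfl

@[simp]
theorem not_refutes_inr (j : Bits d) (v : Bits c) (y : Fin (k + 1) × Bits d) :
    ¬ Refutes j v (.inr y) :=
  id

theorem two_mul_card_filter_dotProduct_ne {v w : Bits c} (h : v ≠ w) :
    2 * (Finset.univ.filter fun x : Bits c => x ⬝ᵥ v ≠ x ⬝ᵥ w).card = 2 ^ c := by
  have ne_iff : ∀ x : Bits c, x ⬝ᵥ v ≠ x ⬝ᵥ w ↔ x ⬝ᵥ (v - w) = 1 := fun x => by
    rw [dotProduct_sub, ← sub_ne_zero]
    generalize x ⬝ᵥ v - x ⬝ᵥ w = b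
    decide +revert
  have card_eq := card_mul_card_filter_dotProduct_eq (sub_ne_zero.2 h) (1 : ZMod 2)
  simpa [ne_iff] using card_eq

theorem sum_sampleLaw_mul_ite_refutes (r : Bits d → Bits c) (s : Fin (k + 1) → Bits d)
    (j : Bits d) {v : Bits c} (hv : v ≠ r j) (q : ℝ≥0∞) :
    ∑ z, sampleLaw r s z * (if Refutes j v z then q else 1) = 4⁻¹ * (3 + q) := by
  have card_ne := two_mul_card_filter_dotProduct_ne hv
  have card_add := Finset.card_filter_add_card_filter_not (s := (Finset.univ : Finset (Bits c)))
    (p := fun x => x ⬝ᵥ v ≠ x ⬝ᵥ r j)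
  rw [Finset.card_univ, show Fintype.card (Bits c) = 2 ^ c by simp] at card_add
  set F := (Finset.univ.filter fun x : Bits c => x ⬝ᵥ v ≠ x ⬝ᵥ r j).card
  have card_not : (Finset.univ.filter fun x : Bits c => ¬ x ⬝ᵥ v ≠ x ⬝ᵥ r j).card = F := by omega
  have half : (2 ^ c : ℝ≥0∞)⁻¹ * F = 2⁻¹ := by
    have F_pos : 0 < F := pos_of_mul_pos_right (card_ne ▸ Nat.two_pow_pos c) (Nat.zero_le 2)
    rw [← Nat.cast_ofNat (n := 2), ← Nat.cast_pow, ← card_ne, Nat.cast_mul,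
      ENNReal.mul_inv (by simp) (by simp), mul_assoc,
      ENNReal.inv_mul_cancel (by simpa using F_pos.ne') (by simp), mul_one]
  rw [sum_sampleLaw_mul]
  simp only [refutes_inl, not_refutes_inr, Finset.sum_ite, Finset.sum_const, card_not,
    nsmul_eq_mul, if_false]
  calc _ = 2⁻¹ * ((2 ^ c : ℝ≥0∞)⁻¹ * F * (q + 1)) + 2⁻¹ * ((k + 1 : ℝ≥0∞)⁻¹ * (k + 1)) := by
        simp only [mul_one, Finset.card_univ, Fintype.card_fin, Nat.cast_add, Nat.cast_one]
        ring
    _ = 2⁻¹ * 2⁻¹ * (q + 1 + 2⁻¹⁻¹) := by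
        rw [half, ENNReal.inv_mul_cancel (by simp) (by finiteness), mul_one, mul_add _ _ 2⁻¹⁻¹,
          mul_assoc 2⁻¹ 2⁻¹ 2⁻¹⁻¹, ENNReal.mul_inv_cancel (by simp) (by simp), mul_one]
        ring
    _ = 4⁻¹ * (3 + q) := by
        rw [← ENNReal.mul_inv (by simp) (by simp), inv_inv, add_assoc, add_comm q]
        norm_num

theorem sampleLaw_eq_zero_of_refutes (r : Bits d → Bits c) (s : Fin (k + 1) → Bits d)
    (j : Bits d) {z : Point c d (k + 1)} (hz : Refutes j (r j) z) : sampleLaw r s z = 0 := by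
  have sum_eq_zero : ∑ z, sampleLaw r s z * (if Refutes j (r j) z then 1 else 0) = 0 := by
    rw [sum_sampleLaw_mul]
    simp
  simpa [hz] using Finset.sum_eq_zero_iff.1 sum_eq_zero z (Finset.mem_univ z)

theorem sum_sampleLaw_mul_ite_refutes_le (r : Bits d → Bits c) (s : Fin (k + 1) → Bits d)
    (j : Bits d) {v : Bits c} (hv : v ≠ r j) :
    ∑ z, sampleLaw r s z *
      (if Refutes j v z then ENNReal.ofReal (Real.exp (-(1 / 8))) else 1) ≤
        ENNReal.ofReal (35 / 36) := by
  have exp_le : Real.exp (-(1 / 8)) ≤ 8 / 9 := by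
    rw [Real.exp_neg, inv_le_comm₀ (Real.exp_pos _) (by norm_num)]
    linarith [Real.add_one_le_exp (1 / 8)]
  rw [sum_sampleLaw_mul_ite_refutes r s j hv]
  calc _ ≤ 4⁻¹ * (3 + ENNReal.ofReal (8 / 9)) := by gcongr
    _ = ENNReal.ofReal (35 / 36) := by
      rw [← ENNReal.toReal_eq_toReal_iff' (by finiteness) (by finiteness)]
      rw [ENNReal.toReal_mul, ENNReal.toReal_add (by finiteness) (by finiteness)]
      norm_num

/-- The number of samples in `x` that contradict the candidate `v` for the string with index `j`. -/
def refutations (x : Fin ℓ → Point c d (k + 1)) (j : Bits d) (v : Bits c) : ℕ :=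
  (Finset.univ.filter fun i => Refutes j v (x i)).card

theorem ofReal_exp_neg_mul_refutations (η : ℝ) (x : Fin ℓ → Point c d (k + 1)) (j : Bits d)
    (v : Bits c) :
    ENNReal.ofReal (Real.exp (-η * refutations x j v)) =
      ∏ i, if Refutes j v (x i) then ENNReal.ofReal (Real.exp (-η)) else 1 := by
  rw [Finset.prod_ite, Finset.prod_const, Finset.prod_const_one, mul_one, mul_comm,
    Real.exp_nat_mul, ENNReal.ofReal_pow (Real.exp_pos _).le, refutations]

/-- The curator's differentially private estimate of the string with index `j`. -/
noncomputable def privateString (x : Fin ℓ → Point c d (k + 1)) (j : Bits d) : PMF (Bits c) :=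
  expMechanism (1 / 8) fun v => (refutations x j v : ℝ)

theorem privateString_le {x x' : Fin ℓ → Point c d (k + 1)} (h : Neighboring x x') (j : Bits d)
    (v : Bits c) :
    privateString x j v ≤ ENNReal.ofReal (Real.exp (1 / 4)) * privateString x' j v := by
  have exponent_eq : (1 / 4 : ℝ) = 2 * (1 / 8) * 1 := by norm_num
  rw [exponent_eq]
  exact expMechanism_le (by norm_num) (fun v => h.abs_card_filter_sub_le_one (Refutes j v)) v

theorem one_le_sum_privateString (r : Bits d → Bits c) (s : Fin (k + 1) → Bits d) (j : Bits d) :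
    1 ≤ (∑ x : Fin ℓ → Point c d (k + 1), (∏ i, sampleLaw r s (x i)) * privateString x j (r j)) +
      ENNReal.ofReal (2 ^ c * (35 / 36) ^ ℓ) := by
  have sample_le : ∀ x : Fin ℓ → Point c d (k + 1), ∏ i, sampleLaw r s (x i) ≤
      (∏ i, sampleLaw r s (x i)) * (privateString x j (r j) + ∑ v ∈ Finset.univ.erase (r j),
        ENNReal.ofReal (Real.exp (-(1 / 8) * refutations x j v))) := by
    intro x
    by_cases exists_refutes : ∃ i, Refutes j (r j) (x i)
    · obtain ⟨i, hi⟩ := exists_refutes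
      rw [Finset.prod_eq_zero (Finset.mem_univ i) (sampleLaw_eq_zero_of_refutes r s j hi), zero_mul]
    · have refutations_eq : refutations x j (r j) = 0 := by
        simpa [refutations, Finset.filter_eq_empty_iff] using exists_refutes
      exact le_mul_of_one_le_right' <|
        one_le_expMechanism_add_sum (1 / 8) (Nat.cast_eq_zero.2 refutations_eq)
  have wrong_le : ∀ v ∈ Finset.univ.erase (r j),
      ∑ x : Fin ℓ → Point c d (k + 1), (∏ i, sampleLaw r s (x i)) *
        ENNReal.ofReal (Real.exp (-(1 / 8) * refutations x j v)) ≤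
          ENNReal.ofReal (35 / 36) ^ ℓ := by
    intro v hv
    simp only [ofReal_exp_neg_mul_refutations]
    rw [sum_prod_mul_prod (sampleLaw r s) fun _ z =>
      if Refutes j v z then ENNReal.ofReal (Real.exp (-(1 / 8))) else 1]
    grw [sum_sampleLaw_mul_ite_refutes_le r s j (Finset.ne_of_mem_erase hv)]
    simp
  calc (1 : ℝ≥0∞) = ∑ x : Fin ℓ → Point c d (k + 1), ∏ i, sampleLaw r s (x i) :=
        (sum_prod_pmf_eq_one _).symm
    _ ≤ _ := Finset.sum_le_sum fun x _ => sample_le x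
    _ = (∑ x : Fin ℓ → Point c d (k + 1), (∏ i, sampleLaw r s (x i)) * privateString x j (r j)) +
        ∑ v ∈ Finset.univ.erase (r j), ∑ x : Fin ℓ → Point c d (k + 1),
          (∏ i, sampleLaw r s (x i)) *
            ENNReal.ofReal (Real.exp (-(1 / 8) * refutations x j v)) := by
        simp only [mul_add, Finset.sum_add_distrib, Finset.mul_sum]
        rw [Finset.sum_comm (s := Finset.univ.erase (r j))]
    _ ≤ _ := by
        grw [Finset.sum_le_card_nsmul _ _ _ wrong_le, Finset.card_le_univ, nsmul_eq_mul,
          ENNReal.ofReal_mul (by positivity), ENNReal.ofReal_pow (by norm_num),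
          ENNReal.ofReal_pow (by norm_num)]
        simp

end LearningParity

section Signs

/-- The sign encoded by a bit. -/
def sgn (b : Bool) : ℝ := if b then 1 else -1

theorem sgn_not (b : Bool) : sgn (!b) = -sgn b := by cases b <;> simp [sgn]

theorem sgn_mul_self (b : Bool) : sgn b * sgn b = 1 := by cases b <;> simp [sgn]

theorem abs_sgn (b : Bool) : |sgn b| = 1 := by cases b <;> simp [sgn]

theorem one_sub_sgn_mul_one_add_sgn_nonneg {l : ℝ} (hl : |l| ≤ 1) (u v : Bool) :
    0 ≤ (1 - l * sgn u) * (1 + l * sgn v) := by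
  have abs_mul_sgn_le : ∀ b, |l * sgn b| ≤ 1 := fun b => by rwa [abs_mul, abs_sgn, mul_one]
  exact mul_nonneg (by linarith [abs_le.1 (abs_mul_sgn_le u)])
    (by linarith [abs_le.1 (abs_mul_sgn_le v)])

theorem sum_eq_zero_of_perm_neg {α : Type*} [Fintype α] (e : Equiv.Perm α) {F : α → ℝ}
    (h : ∀ a, F (e a) = -F a) : ∑ a, F a = 0 := by
  have sum_eq_neg : ∑ a, F a = -∑ a, F a := by
    rw [← Finset.sum_neg_distrib, ← Equiv.sum_comp e]
    exact Finset.sum_congr rfl fun a _ => h a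
  linarith

variable {ι κ : Type*} [Fintype ι] [DecidableEq ι] [Fintype κ]

theorem sum_eq_zero_of_not_neg {F : (ι → Bool) → ℝ} (h : ∀ g, F (fun i => !g i) = -F g) :
    ∑ g, F g = 0 :=
  sum_eq_zero_of_perm_neg (Equiv.piCongrRight fun _ => Equiv.boolNot) h

theorem sum_sgn_eq_zero (a : ι) : ∑ g : ι → Bool, sgn (g a) = 0 :=
  sum_eq_zero_of_not_neg fun g => sgn_not (g a)

theorem sum_sgn_mul_sgn (a b : ι) :
    ∑ g : ι → Bool, sgn (g a) * sgn (g b) =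
      if a = b then (Fintype.card (ι → Bool) : ℝ) else 0 := by
  split_ifs with h
  · simp only [h, sgn_mul_self, Finset.sum_const, Finset.card_univ, nsmul_eq_mul, mul_one]
  · have involutive : Function.Involutive fun g : ι → Bool => Function.update g a (!g a) :=
      fun g => by simp
    refine sum_eq_zero_of_perm_neg involutive.toPerm fun g => ?_
    simp [sgn_not, Function.update_of_ne (Ne.symm h)]

theorem sum_sgn_mul_sgn_mul_sgn (a b p : ι) :
    ∑ g : ι → Bool, sgn (g a) * sgn (g b) * sgn (g p) = 0 :=
  sum_eq_zero_of_not_neg fun g => by simp only [sgn_not]; ring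

theorem sum_biased_mul {a b : ι} (hab : a ≠ b) (l μ : ℝ) (p : ι) :
    ∑ g : ι → Bool, (1 + μ * sgn (g p)) * ((1 - l * sgn (g a)) * (1 + l * sgn (g b))) =
      Fintype.card (ι → Bool) *
        (1 - l * μ * ((if p = a then 1 else 0) - if p = b then 1 else 0)) := by
  have expand : ∀ g : ι → Bool,
      (1 + μ * sgn (g p)) * ((1 - l * sgn (g a)) * (1 + l * sgn (g b))) =
        1 + μ * sgn (g p) - l * sgn (g a) + l * sgn (g b) - l ^ 2 * (sgn (g a) * sgn (g b)) -
          l * μ * (sgn (g p) * sgn (g a)) + l * μ * (sgn (g p) * sgn (g b)) -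
            l ^ 2 * μ * (sgn (g a) * sgn (g b) * sgn (g p)) := fun g => by ring
  simp only [expand, Finset.sum_sub_distrib, Finset.sum_add_distrib, ← Finset.mul_sum,
    sum_sgn_eq_zero, sum_sgn_mul_sgn, sum_sgn_mul_sgn_mul_sgn, if_neg hab, Finset.sum_const,
    Finset.card_univ, nsmul_eq_mul]
  split_ifs <;> ring

theorem prod_one_add_mul_sgn (u : κ → Bool) (l : ℝ) :
    ∏ i, (1 + l * sgn (u i)) =
      (1 + l) ^ (Finset.univ.filter fun i => u i).card *
        (1 - l) ^ (Finset.univ.filter fun i => ¬ u i).card := by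
  rw [← Finset.prod_const, ← Finset.prod_const, ← Finset.prod_ite]
  refine Finset.prod_congr rfl fun i _ => ?_
  cases u i <;> simp [sgn, sub_eq_add_neg]

theorem prod_one_add_mul_sgn_le {u v : κ → Bool} {l : ℝ} (hl₀ : 0 ≤ l) (hl₁ : l ≤ 1)
    (h : (Finset.univ.filter fun i => u i).card ≤ (Finset.univ.filter fun i => v i).card) :
    ∏ i, (1 + l * sgn (u i)) ≤ ∏ i, (1 + l * sgn (v i)) := by
  have card_add := fun u : κ → Bool =>
    Finset.card_filter_add_card_filter_not (s := (Finset.univ : Finset κ)) (p := fun i => u i)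
  obtain ⟨q, hq⟩ := Nat.exists_eq_add_of_le h
  have card_not : (Finset.univ.filter fun i => ¬ u i).card =
      q + (Finset.univ.filter fun i => ¬ v i).card := by
    have := (card_add u).trans (card_add v).symm
    omega
  rw [prod_one_add_mul_sgn, prod_one_add_mul_sgn, hq, card_not, pow_add, pow_add, ← mul_assoc]
  have : 0 ≤ 1 - l := sub_nonneg.2 hl₁
  gcongr
  linarith

theorem pow_card_le_prod_of_card_le {u v : κ → Bool} {l : ℝ} (hl₀ : 0 ≤ l) (hl₁ : l ≤ 1)
    (h : (Finset.univ.filter fun i => u i).card ≤ (Finset.univ.filter fun i => v i).card) :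
    (1 - l ^ 2) ^ Fintype.card κ ≤ ∏ i, (1 - l * sgn (u i)) * (1 + l * sgn (v i)) := by
  have factor_nonneg : ∀ i, 0 ≤ 1 - l * sgn (u i) := fun i => by
    nlinarith [(abs_le.1 (abs_sgn (u i)).le).2]
  calc (1 - l ^ 2) ^ Fintype.card κ = ∏ i, (1 - l * sgn (u i)) * (1 + l * sgn (u i)) := by
        rw [← Finset.card_univ, ← Finset.prod_const]
        exact Finset.prod_congr rfl fun i _ => by linear_combination l ^ 2 * sgn_mul_self (u i)
    _ ≤ ∏ i, (1 - l * sgn (u i)) * (1 + l * sgn (v i)) := by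
        rw [Finset.prod_mul_distrib, Finset.prod_mul_distrib]
        exact mul_le_mul_of_nonneg_left (prod_one_add_mul_sgn_le hl₀ hl₁ h)
          (Finset.prod_nonneg fun i _ => factor_nonneg i)

end Signs

section SignTables

variable {ι : Type*}

/-- The density of the answer of an agent holding `o` with respect to the uniform distribution on
sign tables: the sign at the agent's share, if there is one, is slightly biased. -/
noncomputable def tableDensity (o : Option ι) (g : ι → Bool) : ℝ :=
  o.elim 1 fun p => 1 + 9⁻¹ * sgn (g p)

theorem tableDensity_mem_Icc (o : Option ι) (g : ι → Bool) :
    tableDensity o g ∈ Set.Icc (8 / 9) (10 / 9) := by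
  rcases o with _ | p
  · norm_num [tableDensity]
  · cases h : g p <;> norm_num [tableDensity, sgn, h]

theorem tableDensity_nonneg (o : Option ι) (g : ι → Bool) : 0 ≤ tableDensity o g :=
  le_trans (by norm_num) (tableDensity_mem_Icc o g).1

variable [Fintype ι] [DecidableEq ι]

theorem sum_tableDensity_mul {a b : ι} (hab : a ≠ b) (l : ℝ) (o : Option ι) :
    ∑ g, tableDensity o g * ((1 - l * sgn (g a)) * (1 + l * sgn (g b))) =
      Fintype.card (ι → Bool) *
        (1 - l * 9⁻¹ * ((if o = some a then 1 else 0) - if o = some b then 1 else 0)) := by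
  rcases o with _ | p
  · simpa [tableDensity] using sum_biased_mul hab l 0 a
  · simpa [tableDensity] using sum_biased_mul hab l 9⁻¹ p

theorem sum_tableDensity (o : Option ι) :
    ∑ g, tableDensity o g = Fintype.card (ι → Bool) := by
  rcases o with _ | p
  · simp [tableDensity]
  · simp [tableDensity, Finset.sum_add_distrib, ← Finset.mul_sum, sum_sgn_eq_zero]

/-- The law of the answer of an agent holding `o`. -/
noncomputable def tableLaw (o : Option ι) : PMF (ι → Bool) :=
  PMF.ofFintype (fun g => ENNReal.ofReal ((Fintype.card (ι → Bool) : ℝ)⁻¹ * tableDensity o g)) <| by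
    rw [← ENNReal.ofReal_sum_of_nonneg fun g _ =>
        mul_nonneg (by positivity) (tableDensity_nonneg o g), ← Finset.mul_sum, sum_tableDensity,
      inv_mul_cancel₀ (Nat.cast_ne_zero.2 Fintype.card_ne_zero), ENNReal.ofReal_one]

theorem tableLaw_apply (o : Option ι) (g : ι → Bool) :
    tableLaw o g = ENNReal.ofReal ((Fintype.card (ι → Bool) : ℝ)⁻¹ * tableDensity o g) :=
  rfl

theorem tableLaw_le (o o' : Option ι) (g : ι → Bool) :
    tableLaw o g ≤ ENNReal.ofReal (Real.exp (1 / 4)) * tableLaw o' g := by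
  rw [tableLaw_apply, tableLaw_apply, ← ENNReal.ofReal_mul (Real.exp_pos _).le, mul_left_comm]
  have density_le := (tableDensity_mem_Icc o g).2
  have le_density := (tableDensity_mem_Icc o' g).1
  have le_exp := Real.add_one_le_exp (1 / 4)
  gcongr ENNReal.ofReal (_ * ?_)
  nlinarith

theorem sum_tableLaw_mul {a b : ι} (hab : a ≠ b) {l : ℝ} (hl : |l| ≤ 1) (o : Option ι) :
    ∑ g, tableLaw o g * ENNReal.ofReal ((1 - l * sgn (g a)) * (1 + l * sgn (g b))) =
      ENNReal.ofReal
        (1 - l * 9⁻¹ * ((if o = some a then 1 else 0) - if o = some b then 1 else 0)) := by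
  have mass_nonneg : ∀ g, 0 ≤ (Fintype.card (ι → Bool) : ℝ)⁻¹ * tableDensity o g := fun g =>
    mul_nonneg (by positivity) (tableDensity_nonneg o g)
  simp only [tableLaw_apply, ← ENNReal.ofReal_mul (mass_nonneg _)]
  rw [← ENNReal.ofReal_sum_of_nonneg fun g _ =>
    mul_nonneg (mass_nonneg g) (one_sub_sgn_mul_one_add_sgn_nonneg hl _ _)]
  simp only [mul_assoc _ (tableDensity o _), ← Finset.mul_sum]
  rw [sum_tableDensity_mul hab, inv_mul_cancel_left₀ (Nat.cast_ne_zero.2 Fintype.card_ne_zero)]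

theorem sum_pmf_mul_ofReal {α : Type*} [Fintype α] (p : PMF α) {F : α → ℝ} (hF : ∀ a, 0 ≤ F a) :
    ∑ a, p a * ENNReal.ofReal (F a) = ENNReal.ofReal (∑ a, (p a).toReal * F a) := by
  rw [ENNReal.ofReal_sum_of_nonneg fun a _ => mul_nonneg ENNReal.toReal_nonneg (hF a)]
  refine Finset.sum_congr rfl fun a _ => ?_
  rw [ENNReal.ofReal_mul ENNReal.toReal_nonneg, ENNReal.ofReal_toReal (p.apply_ne_top a)]

theorem sum_bind_tableLaw_mul {a b : ι} (hab : a ≠ b) {l : ℝ} (hl : |l| ≤ 1)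
    (p : PMF (Option ι)) :
    ∑ g, p.bind tableLaw g * ENNReal.ofReal ((1 - l * sgn (g a)) * (1 + l * sgn (g b))) =
      ENNReal.ofReal (1 - l * 9⁻¹ * ((p (some a)).toReal - (p (some b)).toReal)) := by
  have mean_nonneg : ∀ o : Option ι, 0 ≤
      1 - l * 9⁻¹ * ((if o = some a then 1 else 0) - if o = some b then 1 else 0) := fun o => by
    split_ifs <;> linarith [abs_le.1 hl]
  have sum_toReal : ∑ o, (p o).toReal = 1 := by
    rw [← ENNReal.toReal_sum fun o _ => p.apply_ne_top o, sum_pmf_eq_one, ENNReal.toReal_one]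
  rw [sum_pmf_bind_mul]
  simp only [sum_tableLaw_mul hab hl]
  rw [sum_pmf_mul_ofReal p mean_nonneg]
  simp only [mul_sub, mul_ite, mul_one, mul_zero, Finset.sum_sub_distrib, Finset.sum_ite_eq',
    Finset.mem_univ, if_true, sum_toReal]
  congr 1
  ring

theorem mul_sum_prod_le_pow_card {κ Ω : Type*} [Fintype κ] [Fintype Ω]
    (w F : Ω → ℝ≥0∞) (S : Finset (κ → Ω)) {a : ℝ≥0∞} (h : ∀ G ∈ S, a ≤ ∏ i, F (G i)) :
    a * ∑ G ∈ S, ∏ i, w (G i) ≤ (∑ g, w g * F g) ^ Fintype.card κ := by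
  classical
  calc a * ∑ G ∈ S, ∏ i, w (G i) ≤ ∑ G ∈ S, (∏ i, w (G i)) * ∏ i, F (G i) := by
        rw [Finset.mul_sum]
        refine Finset.sum_le_sum fun G hG => ?_
        rw [mul_comm]
        gcongr
        exact h G hG
    _ ≤ ∑ G : κ → Ω, (∏ i, w (G i)) * ∏ i, F (G i) :=
        Finset.sum_le_sum_of_subset (Finset.subset_univ S)
    _ = (∑ g, w g * F g) ^ Fintype.card κ := by
        rw [sum_prod_mul_prod w fun _ => F, Finset.prod_const, Finset.card_univ]

/-- The number of sign tables in `G` that have a positive sign at `a`. -/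
def score {κ : Type*} [Fintype κ] (G : κ → ι → Bool) (a : ι) : ℕ :=
  (Finset.univ.filter fun i => G i a).card

theorem sum_filter_score_le_score_le {κ : Type*} [Fintype κ] [DecidableEq κ] (p : PMF (Option ι))
    {a b : ι} (hab : a ≠ b) {l : ℝ} (hl₀ : 0 ≤ l) (hl₁ : l < 1)
    (hl : 18 * l ≤ (p (some a)).toReal - (p (some b)).toReal) :
    ∑ G : κ → ι → Bool with score G a ≤ score G b, ∏ i, p.bind tableLaw (G i) ≤
      ENNReal.ofReal ((1 - l ^ 2) ^ Fintype.card κ) := by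
  set X := ∑ G : κ → ι → Bool with score G a ≤ score G b, ∏ i, p.bind tableLaw (G i)
  have abs_l_le : |l| ≤ 1 := abs_le.2 ⟨by linarith, hl₁.le⟩
  have pow_pos : 0 < (1 - l ^ 2) ^ Fintype.card κ := pow_pos (by nlinarith) _
  have markov : ENNReal.ofReal ((1 - l ^ 2) ^ Fintype.card κ) * X ≤
      ENNReal.ofReal ((1 - l ^ 2) ^ Fintype.card κ) *
        ENNReal.ofReal ((1 - l ^ 2) ^ Fintype.card κ) := by
    calc _ ≤ (∑ g, p.bind tableLaw g *
            ENNReal.ofReal ((1 - l * sgn (g a)) * (1 + l * sgn (g b)))) ^ Fintype.card κ := by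
          refine mul_sum_prod_le_pow_card _ _ _ fun G hG => ?_
          rw [← ENNReal.ofReal_prod_of_nonneg fun i _ =>
            one_sub_sgn_mul_one_add_sgn_nonneg abs_l_le _ _]
          exact ENNReal.ofReal_le_ofReal <|
            pow_card_le_prod_of_card_le hl₀ hl₁.le (Finset.mem_filter.1 hG).2
      _ ≤ ENNReal.ofReal ((1 - l ^ 2) ^ 2) ^ Fintype.card κ := by
          rw [sum_bind_tableLaw_mul hab abs_l_le]
          gcongr
          nlinarith
      _ = _ := by
          rw [← ENNReal.ofReal_pow (sq_nonneg _), ← ENNReal.ofReal_mul pow_pos.le, pow_right_comm,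
            sq]
  exact (ENNReal.mul_le_mul_iff_right (ENNReal.ofReal_pos.2 pow_pos).ne' ENNReal.ofReal_ne_top).1
    markov

theorem sum_filter_exists_le {α τ : Type*} [Fintype α] (w : α → ℝ≥0∞) (T : Finset τ)
    (A : τ → α → Prop) [∀ t, DecidablePred (A t)] [DecidablePred fun a => ∃ t ∈ T, A t a] :
    ∑ a with ∃ t ∈ T, A t a, w a ≤ ∑ t ∈ T, ∑ a with A t a, w a := by
  simp only [Finset.sum_filter]
  rw [Finset.sum_comm]
  refine Finset.sum_le_sum fun a _ => ?_
  split_ifs with h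
  · obtain ⟨t, ht, hta⟩ := h
    calc w a = if A t a then w a else 0 := (if_pos hta).symm
      _ ≤ ∑ t ∈ T, if A t a then w a else 0 :=
        Finset.single_le_sum (f := fun t => if A t a then w a else 0) (fun _ _ => zero_le) ht
  · exact zero_le

end SignTables

section Decoding

variable {κ T V : Type*} [Fintype κ] [Finite V] [Nonempty V]

/-- The shares with the highest scores. -/
noncomputable def decode (G : κ → T × V → Bool) (t : T) : V :=
  (Finite.exists_max fun v => score G (t, v)).choose

theorem score_le_score_decode (G : κ → T × V → Bool) (t : T) (v : V) :
    score G (t, v) ≤ score G (t, decode G t) :=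
  (Finite.exists_max fun v => score G (t, v)).choose_spec v

theorem exists_score_le_of_decode_ne {G : κ → T × V → Bool} {s : T → V} (h : decode G ≠ s) :
    ∃ t v, v ≠ s t ∧ score G (t, s t) ≤ score G (t, v) :=
  let ⟨t, ht⟩ := Function.ne_iff.1 h
  ⟨t, decode G t, ht, score_le_score_decode G t (s t)⟩

end Decoding

theorem one_le_sum_decode {κ T V : Type*} [Fintype κ] [Fintype T] [Fintype V] [Nonempty V]
    [DecidableEq κ] [DecidableEq T] [DecidableEq V] (q : PMF (T × V → Bool)) (s : T → V) {ε : ℝ≥0∞}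
    (h : ∀ t, ∀ v ≠ s t,
      ∑ G : κ → T × V → Bool with score G (t, s t) ≤ score G (t, v), ∏ i, q (G i) ≤ ε) :
    1 ≤ (∑ G : κ → T × V → Bool with decode G = s, ∏ i, q (G i)) +
      Fintype.card T * Fintype.card V * ε := by
  let wrong : Finset (T × V) := {p | p.2 ≠ s p.1}
  have sum_ne_le : ∑ G : κ → T × V → Bool with decode G ≠ s, ∏ i, q (G i) ≤
      Fintype.card T * Fintype.card V * ε := by
    calc _ ≤ ∑ G : κ → T × V → Bool with ∃ p ∈ wrong, score G (p.1, s p.1) ≤ score G p,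
            ∏ i, q (G i) := by
          refine Finset.sum_le_sum_of_subset (Finset.monotone_filter_right _ fun G _ hG => ?_)
          obtain ⟨t, v, hv, hle⟩ := exists_score_le_of_decode_ne hG
          exact ⟨(t, v), by simpa [wrong] using hv, hle⟩
      _ ≤ ∑ p ∈ wrong, ∑ G : κ → T × V → Bool with score G (p.1, s p.1) ≤ score G p,
            ∏ i, q (G i) := sum_filter_exists_le _ _ _
      _ ≤ wrong.card • ε :=
          Finset.sum_le_card_nsmul _ _ _ fun p hp => h p.1 p.2 (by simpa [wrong] using hp)
      _ ≤ Fintype.card T * Fintype.card V * ε := by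
          grw [nsmul_eq_mul, Finset.card_le_univ wrong, Fintype.card_prod, Nat.cast_mul]
  calc (1 : ℝ≥0∞) = ∑ G : κ → T × V → Bool, ∏ i, q (G i) := (sum_prod_pmf_eq_one q).symm
    _ = (∑ G with decode G = s, ∏ i, q (G i)) + ∑ G with decode G ≠ s, ∏ i, q (G i) :=
        (Finset.sum_filter_add_sum_filter_not _ _ _).symm
    _ ≤ _ := by gcongr

section AgentSamples

variable {c d k : ℕ}

theorem map_getRight_sampleLaw_apply (r : Bits d → Bits c) (s : Fin (k + 1) → Bits d)
    (t : Fin (k + 1)) (v : Bits d) :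
    (sampleLaw r s).map Sum.getRight? (some (t, v)) =
      if s t = v then 2⁻¹ * (k + 1 : ℝ≥0∞)⁻¹ else 0 := by
  have some_eq_iff : ∀ t', some (t', s t') = some (t, v) ↔ t' = t ∧ s t = v := fun t' => by
    rw [Option.some_inj, Prod.ext_iff]
    exact and_congr_right fun ht : t' = t => by rw [ht]
  calc _ = ∑ o, (sampleLaw r s).map Sum.getRight? o * if o = some (t, v) then 1 else 0 := by simp
    _ = _ := by
      rw [sum_pmf_map_mul, sum_sampleLaw_mul]
      simp [some_eq_iff, ite_and]

theorem one_le_sum_agents_decode {n : ℕ} (r : Bits d → Bits c) (s : Fin (k + 1) → Bits d) :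
    1 ≤ (∑ y : Fin n → Point c d (k + 1), (∏ i, sampleLaw r s (y i)) *
        ∑ G : Fin n → Fin (k + 1) × Bits d → Bool with decode G = s,
          ∏ i, tableLaw (y i).getRight? (G i)) +
      ENNReal.ofReal ((k + 1) * 2 ^ d * (1 - (36 * (k + 1 : ℝ))⁻¹ ^ 2) ^ n) := by
  set p := (sampleLaw r s).map Sum.getRight?
  have bind_eq : (sampleLaw r s).bind (fun z => tableLaw z.getRight?) = p.bind tableLaw :=
    (PMF.bind_map (sampleLaw r s) Sum.getRight? tableLaw).symm
  have wrong_le : ∀ t, ∀ v ≠ s t,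
      ∑ G : Fin n → Fin (k + 1) × Bits d → Bool with score G (t, s t) ≤ score G (t, v),
        ∏ i, p.bind tableLaw (G i) ≤ ENNReal.ofReal ((1 - (36 * (k + 1 : ℝ))⁻¹ ^ 2) ^ n) := by
    intro t v hv
    have gap : 18 * (36 * (k + 1 : ℝ))⁻¹ ≤
        (p (some (t, s t))).toReal - (p (some (t, v))).toReal := by
      rw [map_getRight_sampleLaw_apply, map_getRight_sampleLaw_apply, if_pos rfl, if_neg hv.symm,
        ENNReal.toReal_zero, sub_zero, ENNReal.toReal_mul, ENNReal.toReal_inv, ENNReal.toReal_inv,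
        ENNReal.toReal_add (by finiteness) (by finiteness), ENNReal.toReal_natCast,
        ENNReal.toReal_one, ENNReal.toReal_ofNat]
      field_simp
      norm_num
    simpa using sum_filter_score_le_score_le (κ := Fin n) p (by simpa using hv.symm) (by positivity)
      (inv_lt_one_of_one_lt₀ (by linarith [Nat.cast_nonneg (α := ℝ) k])) gap
  rw [sum_prod_pmf_mul_sum_prod _ fun z : Point c d (k + 1) => tableLaw z.getRight?, bind_eq]
  refine (one_le_sum_decode (κ := Fin n) (p.bind tableLaw) s wrong_le).trans_eq ?_
  rw [ENNReal.ofReal_mul (by positivity), ENNReal.ofReal_mul (by positivity),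
    ENNReal.ofReal_pow zero_le_two, ENNReal.ofReal_add (by positivity) zero_le_one]
  simp

end AgentSamples

section HybridProtocol

/-- The messages of the hybrid protocol: sign tables, queried indices, and strings. -/
abbrev HybridMsg (c d m : ℕ) : Type := (Fin (m + 1) × Bits d → Bool) ⊕ Bits d ⊕ Bits c

/-- The curator runs the exponential mechanism for the string with the index it was sent last. -/
noncomputable def hybridCurator (c d m : ℕ) : Party (Point c d (m + 1)) m (HybridMsg c d m) :=
  Party.ofKernel (fun x j => (privateString x j).map (.inr ∘ .inr))
    fun h => match h.getLast? with
      | some (.inr (.inl j)) => j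
      | _ => 0

/-- The agents answer with noisy sign tables. -/
noncomputable def hybridAgent (c d m : ℕ) : Party (Point c d (m + 1)) 1 (HybridMsg c d m) :=
  Party.ofKernel (fun z (_ : Unit) => (tableLaw (z 0).getRight?).map .inl) fun _ => ()

theorem hybridCurator_isPrivate (c d m : ℕ) : (hybridCurator c d m).IsPrivate 1 (1 / 4) :=
  Party.ofKernel_isPrivate_one
    (fun _ _ h j => pmf_map_apply_le_mul (fun v => privateString_le h j v) _) _

theorem hybridAgent_isPrivate (c d m : ℕ) : (hybridAgent c d m).IsPrivate 1 (1 / 4) :=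
  Party.ofKernel_isPrivate_one
    (fun _ _ _ _ => pmf_map_apply_le_mul (fun g => tableLaw_le _ _ g) _) _

theorem hybridCurator_law {c d m : ℕ} (x : Fin m → Point c d (m + 1)) (j : Bits d) (v : Bits c) :
    (hybridCurator c d m).law
        {ω | (hybridCurator c d m).reply x ω [.inr (.inl j)] = .inr (.inr v)} =
      privateString x j v :=
  (Party.law_reply_ofKernel _ _ x _ _).trans
    (pmf_map_apply_of_injective _ (Sum.inr_injective.comp Sum.inr_injective) v)

theorem hybridAgent_law {c d m : ℕ} (z : Point c d (m + 1)) (h : List (HybridMsg c d m))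
    (g : Fin (m + 1) × Bits d → Bool) :
    (hybridAgent c d m).law {ω | (hybridAgent c d m).reply (fun _ => z) ω h = .inl g} =
      tableLaw z.getRight? g :=
  (Party.law_reply_ofKernel _ _ _ h _).trans (pmf_map_apply_of_injective _ Sum.inl_injective g)

/-- The agents send noisy sign tables from which the referee decodes the shares; then
the curator runs the exponential mechanism for the string with the decoded index. -/
noncomputable def hybridProtocol (c d m n : ℕ) :
    Protocol (Point c d (m + 1)) (Bits c) [.agents, .curator] m n where
  Msg := HybridMsg c d m
  curator := hybridCurator c d m
  agent _ := hybridAgent c d m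
  RefCoins := Unit
  refLaw := Measure.dirac ()
  toCurator _ view := match view.head? with
    | some (.inr b) =>
      .inr (.inl (∑ t, decode (fun i => (b i).elim id fun _ _ => false) t))
    | _ => .inr (.inl 0)
  toAgent _ _ _ := .inr (.inl 0)
  output _ view := match view.getLast? with
    | some (.inl (.inr (.inr v))) => v
    | _ => 0
  measurableSet_toCurator _ _ := MeasurableSet.of_discrete
  measurableSet_toAgent _ _ _ := MeasurableSet.of_discrete
  measurableSet_output _ _ := MeasurableSet.of_discrete

variable {c d m n : ℕ}

theorem hybridProtocol_isPrivate : (hybridProtocol c d m n).IsPrivate (1 / 4) :=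
  ⟨hybridCurator_isPrivate c d m, fun _ => hybridAgent_isPrivate c d m⟩

theorem hybridProtocol_agentsIgnoreMessages :
    (hybridProtocol c d m n).AgentsIgnoreMessages := fun _ _ _ _ _ _ => rfl

/-- The event that the agents holding `y` answer with sign tables that decode to `s`. -/
def decodeEvent (y : Fin n → Point c d (m + 1)) (s : Fin (m + 1) → Bits d) :
    Set (Fin n → (hybridAgent c d m).Coins) :=
  ⋃ G ∈ ({G | decode G = s} : Finset (Fin n → Fin (m + 1) × Bits d → Bool)), Set.univ.pi fun i =>
    {ω | (hybridAgent c d m).reply (fun _ => y i) ω [.inr (.inl 0)] = .inl (G i)}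

theorem measure_decodeEvent (y : Fin n → Point c d (m + 1)) (s : Fin (m + 1) → Bits d) :
    (Measure.pi fun _ => (hybridAgent c d m).law) (decodeEvent y s) =
      ∑ G : Fin n → Fin (m + 1) × Bits d → Bool with decode G = s,
        ∏ i, tableLaw (y i).getRight? (G i) := by
  rw [decodeEvent, measure_biUnion_finset]
  · simp only [Measure.pi_pi, hybridAgent_law]
  · intro G _ G' _ hne
    rw [Function.onFun, Set.disjoint_left]
    intro ω h h'
    exact hne (funext fun i => Sum.inl_injective ((h i trivial).symm.trans (h' i trivial)))
  · exact fun G _ => MeasurableSet.univ_pi fun i => (hybridAgent c d m).measurableSet_reply _ _ _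

theorem hybridProtocol_result_eq (x : Fin m → Point c d (m + 1)) {y : Fin n → Point c d (m + 1)}
    {s : Fin (m + 1) → Bits d} {v : Bits c} (ρ : Unit) {ωc : (hybridCurator c d m).Coins}
    {ωa : Fin n → (hybridAgent c d m).Coins}
    (hc : (hybridCurator c d m).reply x ωc [.inr (.inl (∑ t, s t))] = .inr (.inr v))
    (ha : ωa ∈ decodeEvent y s) : (hybridProtocol c d m n).result x y (ρ, ωc, ωa) = v := by
  let P := hybridProtocol c d m n
  obtain ⟨G, hG, hωG⟩ := Set.mem_iUnion₂.1 ha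
  have decode_eq : decode G = s := (Finset.mem_filter.1 hG).2
  have replies_eq : (fun i => (hybridAgent c d m).reply (fun _ => y i) (ωa i) [.inr (.inl 0)]) =
      fun i => .inl (G i) := funext fun i => hωG i trivial
  have query_eq : P.toCurator ρ [.inr fun i => .inl (G i)] =
      (.inr (.inl (∑ t, s t)) : HybridMsg c d m) := by
    rw [← decode_eq]
    rfl
  change P.output ρ [.inr fun i => (hybridAgent c d m).reply (fun _ => y i) (ωa i) [.inr (.inl 0)],
    .inl ((hybridCurator c d m).reply x ωc [P.toCurator ρ
      [.inr fun i => (hybridAgent c d m).reply (fun _ => y i) (ωa i) [.inr (.inl 0)]]])] = v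
  rw [replies_eq, query_eq, hc]
  rfl

theorem le_outputProb_hybridProtocol (x : Fin m → Point c d (m + 1))
    (y : Fin n → Point c d (m + 1)) (s : Fin (m + 1) → Bits d) (v : Bits c) :
    privateString x (∑ t, s t) v *
        (∑ G : Fin n → Fin (m + 1) × Bits d → Bool with decode G = s,
          ∏ i, tableLaw (y i).getRight? (G i)) ≤
      (hybridProtocol c d m n).outputProb x y v := by
  let curatorEvent : Set (hybridCurator c d m).Coins :=
    {ω | (hybridCurator c d m).reply x ω [.inr (.inl (∑ t, s t))] = .inr (.inr v)}
  calc _ = ((Measure.dirac ()).prod ((hybridCurator c d m).law.prod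
          (Measure.pi fun _ => (hybridAgent c d m).law)))
            (Set.univ ×ˢ (curatorEvent ×ˢ decodeEvent y s)) := by
        rw [Measure.prod_prod, Measure.prod_prod, hybridCurator_law, measure_decodeEvent,
          measure_univ, one_mul]
    _ ≤ _ := measure_mono fun ⟨ρ, _, _⟩ ⟨_, hc, ha⟩ => hybridProtocol_result_eq x ρ hc ha

theorem hybridProtocol_solves (hcm : (2 : ℝ) ^ c * (35 / 36) ^ m ≤ 1 / 8)
    (hmn : (m + 1) * 2 ^ d * (1 - (36 * (m + 1 : ℝ))⁻¹ ^ 2) ^ n ≤ 1 / 8) :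
    SolvesOneOutOfParity (hybridProtocol c d m n) (1 / 4) := by
  intro r s
  have le_of_one_le_add : ∀ {a : ℝ≥0∞} {b : ℝ}, 1 ≤ a + ENNReal.ofReal b → b ≤ 1 / 8 →
      ENNReal.ofReal (7 / 8) ≤ a := fun {a b} h hb => by
    rw [← ENNReal.add_le_add_iff_right (ENNReal.ofReal_ne_top (r := 1 / 8)),
      ← ENNReal.ofReal_add (by norm_num) (by norm_num)]
    grw [← hb, ← h]
    norm_num
  have curator_le := le_of_one_le_add (one_le_sum_privateString (ℓ := m) r s (∑ t, s t)) hcm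
  have agents_le := le_of_one_le_add (one_le_sum_agents_decode (n := n) r s) hmn
  calc ENNReal.ofReal (1 - 1 / 4) ≤ ENNReal.ofReal (7 / 8) * ENNReal.ofReal (7 / 8) := by
        rw [← ENNReal.ofReal_mul (by norm_num)]
        exact ENNReal.ofReal_le_ofReal (by norm_num)
    _ ≤ _ := mul_le_mul' curator_le agents_le
    _ ≤ _ := by
        rw [Finset.sum_mul_sum]
        refine Finset.sum_le_sum fun x _ => Finset.sum_le_sum fun y _ => ?_
        rw [mul_mul_mul_comm]
        gcongr
        exact le_outputProb_hybridProtocol x y s _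

end HybridProtocol

section Parameters

/-- The number of binary digits of `c ≥ 1`, which stands for `log c` in the parameters. -/
def binaryLength (c : ℕ) : ℕ := Nat.log 2 c + 1

/-- The length `d` of the indices of the strings. -/
def indexLength (c : ℕ) : ℕ := 3 * binaryLength c + 36

/-- The number `m` of points held by the curator. -/
def curatorSize (c : ℕ) : ℕ := 127 * c

/-- The number `n` of agents. -/
def agentCount (c : ℕ) : ℕ := 2 ^ 31 * c ^ 2 * binaryLength c

theorem lt_two_pow_binaryLength (c : ℕ) : c < 2 ^ binaryLength c :=
  Nat.lt_pow_succ_log_self (by norm_num) c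

theorem one_le_binaryLength (c : ℕ) : 1 ≤ binaryLength c := Nat.le_add_left 1 _

theorem three_le_indexLength (c : ℕ) : 3 ≤ indexLength c :=
  Nat.le_add_left_of_le (by norm_num)

theorem log_le_binaryLength (c : ℕ) : Real.log c ≤ binaryLength c := by
  rcases c.eq_zero_or_pos with rfl | hc
  · simp only [Nat.cast_zero, Real.log_zero, Nat.cast_nonneg]
  have le_pow : (c : ℝ) ≤ 2 ^ binaryLength c := by exact_mod_cast (lt_two_pow_binaryLength c).le
  calc Real.log c ≤ Real.log (2 ^ binaryLength c) := Real.log_le_log (by positivity) le_pow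
    _ = binaryLength c * Real.log 2 := Real.log_pow _ _
    _ ≤ binaryLength c :=
        mul_le_of_le_one_right (Nat.cast_nonneg _) (Real.log_two_lt_d9.le.trans (by norm_num))

theorem binaryLength_le_four_mul_log {c : ℕ} (hc : 2 ≤ c) :
    (binaryLength c : ℝ) ≤ 4 * Real.log c := by
  have pow_le : (2 : ℝ) ^ Nat.log 2 c ≤ c := by
    exact_mod_cast Nat.pow_log_le_self 2 (by omega)
  have mul_log_two_le : Nat.log 2 c * Real.log 2 ≤ Real.log c :=
    (Real.log_pow _ _).symm.trans_le (Real.log_le_log (by positivity) pow_le)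
  have one_le_log : (1 : ℝ) ≤ Nat.log 2 c := by exact_mod_cast Nat.log_pos (by norm_num) hc
  have half_le_log_two : 1 / 2 ≤ Real.log 2 := Real.log_two_gt_d9.le.trans' (by norm_num)
  rw [binaryLength, Nat.cast_succ]
  nlinarith

theorem isTheta_principal_of_nonneg {α : Type*} {s : Set α} {f g : α → ℝ} (a b : ℝ)
    (hf : ∀ x ∈ s, 0 ≤ f x) (hg : ∀ x ∈ s, 0 ≤ g x) (hfg : ∀ x ∈ s, f x ≤ a * g x)
    (hgf : ∀ x ∈ s, g x ≤ b * f x) : f =Θ[𝓟 s] g := by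
  constructor
  · refine IsBigO.of_bound a (eventually_principal.2 fun x hx => ?_)
    rw [Real.norm_of_nonneg (hf x hx), Real.norm_of_nonneg (hg x hx)]
    exact hfg x hx
  · refine IsBigO.of_bound b (eventually_principal.2 fun x hx => ?_)
    rw [Real.norm_of_nonneg (hf x hx), Real.norm_of_nonneg (hg x hx)]
    exact hgf x hx

theorem isTheta_binaryLength :
    (fun c : ℕ => (binaryLength c : ℝ)) =Θ[𝓟 (Set.Ici 2)] fun c : ℕ => Real.log c :=
  isTheta_principal_of_nonneg 4 1 (fun _ _ => Nat.cast_nonneg _)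
    (fun c _ => Real.log_natCast_nonneg c) (fun _ hc => binaryLength_le_four_mul_log hc)
    fun c _ => (log_le_binaryLength c).trans_eq (one_mul _).symm

theorem isTheta_indexLength :
    (fun c : ℕ => (indexLength c : ℝ)) =Θ[𝓟 (Set.Ici 2)] fun c : ℕ => Real.log c := by
  refine IsTheta.trans (isTheta_principal_of_nonneg 39 1 (fun _ _ => Nat.cast_nonneg _)
    (fun _ _ => Nat.cast_nonneg _) (fun c _ => ?_) fun c _ => ?_) isTheta_binaryLength
  all_goals
    have := one_le_binaryLength c
    rw [indexLength]
    norm_cast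
    omega

theorem isTheta_curatorSize (l : Filter ℕ) :
    (fun c : ℕ => (curatorSize c : ℝ)) =Θ[l] fun c : ℕ => (c : ℝ) := by
  simp only [curatorSize, Nat.cast_mul]
  exact (isTheta_const_mul_left (by norm_num)).2 (isTheta_refl _ _)

theorem isTheta_agentCount :
    (fun c : ℕ => (agentCount c : ℝ)) =Θ[𝓟 (Set.Ici 2)] fun c : ℕ => (c : ℝ) ^ 2 * Real.log c := by
  simp only [agentCount, Nat.cast_mul, Nat.cast_pow]
  exact ((isTheta_const_mul_left (by norm_num)).2 (isTheta_refl _ _)).mul isTheta_binaryLength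

theorem sixteen_mul_samples_add_le {c : ℕ} (hc : 1 ≤ c) :
    16 * (curatorSize c + agentCount c) + 128 ≤ 2 ^ indexLength c := by
  set L := binaryLength c
  have one_le_L : 1 ≤ L := one_le_binaryLength c
  have agents_le : c ^ 2 * L ≤ (2 ^ L) ^ 2 * 2 ^ L :=
    Nat.mul_le_mul (Nat.pow_le_pow_left (lt_two_pow_binaryLength c).le 2) Nat.lt_two_pow_self.le
  have le_agents : c ≤ c ^ 2 * L := by nlinarith
  calc 16 * (127 * c + 2 ^ 31 * c ^ 2 * L) + 128 = 16 * 2 ^ 31 * (c ^ 2 * L) + 2032 * c + 128 := by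
        ring
    _ ≤ 2 ^ 36 * (c ^ 2 * L) := by omega
    _ ≤ 2 ^ 36 * ((2 ^ L) ^ 2 * 2 ^ L) := by gcongr
    _ = 2 ^ (3 * L + 36) := by ring

theorem two_pow_mul_pow_curatorSize_le {c : ℕ} (hc : 1 ≤ c) :
    (2 : ℝ) ^ c * (35 / 36) ^ curatorSize c ≤ 1 / 8 :=
  calc (2 : ℝ) ^ c * (35 / 36) ^ (127 * c) = (2 * (35 / 36) ^ 127) ^ c := by
        rw [pow_mul, ← mul_pow]
    _ ≤ (1 / 8) ^ c := pow_le_pow_left₀ (by positivity) (by norm_num) c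
    _ ≤ 1 / 8 := pow_le_of_le_one (by norm_num) (by norm_num) (by omega)

theorem one_sub_pow_le_half_pow {x : ℝ} (hx : x ≤ 1) {N j : ℕ} (hj : j ≤ N * x) :
    (1 - x) ^ N ≤ (1 / 2) ^ j :=
  calc (1 - x) ^ N ≤ Real.exp (-x) ^ N :=
        pow_le_pow_left₀ (by linarith) (Real.one_sub_le_exp_neg x) _
    _ = Real.exp (-(N * x)) := by rw [← Real.exp_nat_mul, mul_neg]
    _ ≤ Real.exp (j * -1) := by
        gcongr
        linarith
    _ = Real.exp (-1) ^ j := Real.exp_nat_mul _ _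
    _ ≤ (1 / 2) ^ j := by
        gcongr
        rw [Real.exp_neg, one_div]
        gcongr
        exact Real.exp_one_gt_d9.le.trans' (by norm_num)

theorem one_sub_sq_nonneg (c : ℕ) : 0 ≤ 1 - (36 * (curatorSize c + 1 : ℝ))⁻¹ ^ 2 :=
  sub_nonneg.2 <| pow_le_one₀ (by positivity) <| inv_le_one_of_one_le₀ <| by
    linarith [Nat.cast_nonneg (α := ℝ) (curatorSize c)]

theorem one_sub_sq_pow_le {c : ℕ} (hc : 1 ≤ c) :
    (1 - (36 * (curatorSize c + 1 : ℝ))⁻¹ ^ 2) ^ (2 ^ 31 * c ^ 2) ≤ (1 / 2) ^ 64 := by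
  have size_le : (curatorSize c + 1 : ℝ) ≤ 128 * c := by
    rw [curatorSize]
    norm_cast
    omega
  refine one_sub_pow_le_half_pow (sub_nonneg.1 (one_sub_sq_nonneg c)) ?_
  rw [inv_pow, ← div_eq_mul_inv, le_div_iff₀ (by positivity)]
  calc (64 : ℕ) * (36 * (curatorSize c + 1 : ℝ)) ^ 2 ≤ (64 : ℕ) * (36 * (128 * c)) ^ 2 := by gcongr
    _ = (64 * (36 * 128) ^ 2) * (c : ℝ) ^ 2 := by ring
    _ ≤ 2 ^ 31 * c ^ 2 := by gcongr; norm_num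
    _ = _ := by norm_cast

theorem decoding_error_le {c : ℕ} (hc : 1 ≤ c) :
    (curatorSize c + 1) * 2 ^ indexLength c *
      (1 - (36 * (curatorSize c + 1 : ℝ))⁻¹ ^ 2) ^ agentCount c ≤ 1 / 8 := by
  set L := binaryLength c
  have one_le_L : 1 ≤ L := one_le_binaryLength c
  have size_le : (curatorSize c + 1 : ℝ) ≤ 2 ^ (L + 7) := by
    have lt_pow : c < 2 ^ L := lt_two_pow_binaryLength c
    rw [curatorSize, pow_add]
    norm_cast
    omega
  have error_pow_le : (1 - (36 * (curatorSize c + 1 : ℝ))⁻¹ ^ 2) ^ agentCount c ≤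
      ((1 / 2) ^ 64) ^ L := by
    rw [agentCount, pow_mul]
    exact pow_le_pow_left₀ (pow_nonneg (one_sub_sq_nonneg c) _) (one_sub_sq_pow_le hc) L
  calc (curatorSize c + 1) * 2 ^ indexLength c *
        (1 - (36 * (curatorSize c + 1 : ℝ))⁻¹ ^ 2) ^ agentCount c
      ≤ 2 ^ (L + 7) * 2 ^ (3 * L + 36) * ((1 / 2) ^ 64) ^ L :=
        mul_le_mul (mul_le_mul_of_nonneg_right size_le (by positivity)) error_pow_le
          (pow_nonneg (one_sub_sq_nonneg c) _) (by positivity)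
    _ = 2 ^ (4 * L + 43) / 2 ^ (64 * L) := by
        rw [← pow_mul, one_div_pow, mul_one_div, ← pow_add]
        ring_nf
    _ ≤ 1 / 8 := by
        rw [div_le_div_iff₀ (by positivity) (by norm_num), one_mul]
        calc (2 : ℝ) ^ (4 * L + 43) * 8 = 2 ^ (4 * L + 46) := by ring
          _ ≤ 2 ^ (64 * L) := pow_le_pow_right₀ one_le_two (by omega)

theorem eventually_agentCount_le_two_pow :
    ∀ᶠ c : ℕ in atTop, 16 * (agentCount c + 1) ^ 2 ≤ 2 ^ c := by
  have tendsto_zero := tendsto_pow_const_div_const_pow_of_one_lt 6 (r := (2 : ℝ)) (by norm_num)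
  filter_upwards [tendsto_zero.eventually (gt_mem_nhds (show (0 : ℝ) < 1 / 2 ^ 70 by positivity)),
    eventually_ge_atTop 1] with c pow_div_lt one_le_c
  have length_le : binaryLength c ≤ 2 * c := by
    have := Nat.log_lt_self 2 (x := c) (by omega)
    rw [binaryLength]
    omega
  rw [div_lt_div_iff₀ (by positivity) (by positivity)] at pow_div_lt
  have pow_lt : c ^ 6 * 2 ^ 70 < 1 * 2 ^ c := by exact_mod_cast pow_div_lt
  calc 16 * (2 ^ 31 * c ^ 2 * binaryLength c + 1) ^ 2
      ≤ 16 * (2 ^ 31 * c ^ 2 * (2 * c) + c ^ 3) ^ 2 := by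
        gcongr
        exact Nat.one_le_pow _ _ one_le_c
    _ = (16 * (2 ^ 32 + 1) ^ 2) * c ^ 6 := by ring
    _ ≤ 2 ^ 70 * c ^ 6 := by gcongr; norm_num
    _ ≤ 2 ^ c := by omega

theorem eventually_not_solvesOneOutOfParity_of_local :
    ∀ᶠ c : ℕ in atTop, ∀ (d k : ℕ) (σ : List Round)
      (P : Protocol (Point c d (k + 1)) (Bits c) σ 0 (agentCount c)),
      P.IsPrivate (1 / 4) → ¬ SolvesOneOutOfParity P (1 / 4) := by
  filter_upwards [eventually_agentCount_le_two_pow] with c le_pow d k σ P hP hsol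
  exact (two_pow_lt_of_local hP hsol).not_ge le_pow

end Parameters

end HybridDP

theorem mainTheorem2 :
    ∃ d m n : ℕ → ℕ,
      (fun c : ℕ => (d c : ℝ)) =Θ[𝓟 (Set.Ici 2)] (fun c : ℕ => Real.log c) ∧
      (fun c : ℕ => (m c : ℝ)) =Θ[𝓟 (Set.Ici 2)] (fun c : ℕ => (c : ℝ)) ∧
      (fun c : ℕ => (n c : ℝ)) =Θ[𝓟 (Set.Ici 2)] (fun c : ℕ => (c : ℝ) ^ 2 * Real.log c) ∧
      (∀ c : ℕ, 1 ≤ c →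
        -- hybrid model, agents first (one message each), then one exchange with the curator
        (∃ P : HybridDP.Protocol (HybridDP.Point c (d c) (m c + 1)) (HybridDP.Bits c)
            [.agents, .curator] (m c) (n c),
          P.IsPrivate (1 / 4) ∧ P.AgentsIgnoreMessages ∧
            HybridDP.SolvesOneOutOfParity P (1 / 4)) ∧
        -- hybrid model, any number of exchanges with the curator, then one with the agents
        (∀ k : ℕ, ¬ ∃ P : HybridDP.Protocol (HybridDP.Point c (d c) (m c + 1)) (HybridDP.Bits c)
            (List.replicate k .curator ++ [.agents]) (m c) (n c),
          P.IsPrivate (1 / 4) ∧ HybridDP.SolvesOneOutOfParity P (1 / 4)) ∧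
        -- curator alone, with or without privacy
        (∀ k : ℕ, ¬ ∃ P : HybridDP.Protocol (HybridDP.Point c (d c) (m c + 1)) (HybridDP.Bits c)
            (List.replicate k .curator) (m c) 0,
          HybridDP.SolvesOneOutOfParity P (1 / 4))) ∧
      -- local model with `T` rounds
      (∃ γ : ℝ, 0 < γ ∧ ∀ᶠ c : ℕ in atTop, ∀ (T : ℕ)
        (P : HybridDP.Protocol (HybridDP.Point c (d c) (m c + 1)) (HybridDP.Bits c)
            (List.replicate T .agents) 0 (n c)),
          P.IsPrivate (1 / 4) → HybridDP.SolvesOneOutOfParity P (1 / 4) →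
            (2 : ℝ) ^ (γ * c) ≤ T ∧
            (2 : ℝ) ^ (γ * Real.sqrt (n c / Real.log (n c))) ≤ T) := by
  refine ⟨HybridDP.indexLength, HybridDP.curatorSize, HybridDP.agentCount,
    HybridDP.isTheta_indexLength, HybridDP.isTheta_curatorSize _, HybridDP.isTheta_agentCount,
    fun c hc => ⟨?hybrid, ?curatorFirst, ?curatorAlone⟩, ?localModel⟩
  case hybrid =>
    exact ⟨HybridDP.hybridProtocol _ _ _ _, HybridDP.hybridProtocol_isPrivate,
      HybridDP.hybridProtocol_agentsIgnoreMessages,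
      HybridDP.hybridProtocol_solves (HybridDP.two_pow_mul_pow_curatorSize_le hc)
        (HybridDP.decoding_error_le hc)⟩
  case curatorFirst =>
    rintro k ⟨P, hP, hsol⟩
    exact HybridDP.not_solvesOneOutOfParity_of_curator_first hc (HybridDP.three_le_indexLength c)
      (HybridDP.sixteen_mul_samples_add_le hc) hP hsol
  case curatorAlone =>
    rintro k ⟨P, hsol⟩
    exact HybridDP.not_solvesOneOutOfParity_of_no_agents hc
      ((HybridDP.three_le_indexLength c).trans' (by norm_num)) le_rfl (by norm_num) P hsol
  case localModel =>
    -- The lower bound on the number of agents holds for any number of rounds, so that `n c` agents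
    -- are too few for large `c`.
    refine ⟨1, one_pos, ?_⟩
    filter_upwards [HybridDP.eventually_not_solvesOneOutOfParity_of_local] with c not_solves T P hP
    exact fun hsol => (not_solves _ _ _ P hP hsol).elim
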